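/- Let $d\ge 2$ and $H_d=\sum_{k=1}^d 1/k$. On $\mathbb C^d\otimes\mathbb C^d$ (Alice $\otimes$ Bob) let $$W_d^\eta=(1-\eta)\,\frac{I}{d^2}+\eta\,|\psi_+\rangle\langle\psi_+|,\qquad \psi_+=\frac1{\sqrt d}\sum_{i=1}^d|i\rangle|i\rangle ,$$ where $\eta$ is any real number for which $W_d^\eta$ is a state (positive semidefinite of trace $1$). For a Hermitian $A$ and an eigenvalue $a$ of $A$ let $\Pi_a^A$ be the orthogonal projector onto the eigenspace. A set $\mathfrak M$ of Hermitian matrices (projective measurements of Alice) *exhibits steering* on a state $W$ if there is no hidden-state model, that is, no random variable $\xi$ with a probability law $\wp$, no measurable family of states $\rho_\xi$ of Bob and no response probabilities $\wp(a|A,\xi)\ge 0$, measurable in $\xi$, with $\sum_a\wp(a|A,\xi)=1$, such that $$\mathrm{Tr}[(\Pi_a^A\otimes\Pi_b^B)W]=\int \wp(a|A,\xi)\,\mathrm{Tr}[\Pi_b^B\rho_\xi]\,d\wp(\xi)$$ for all $A\in\mathfrak M$, all Hermitian $B$ and all eigenvalues $a$ of $A$ and $b$ of $B$. The state $W$ is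 *steerable* (by Alice) if some set $\mathfrak M$ exhibits steering on $W$. 1. $W_d^\eta$ is steerable if and only if $\eta>\dfrac{H_d-1}{d-1}$. The same condition is necessary and sufficient for the set of all projective measurements to exhibit steering on $W_d^\eta$. 2. $\dfrac{H_d-1}{d-1}\sim\dfrac{\ln d}{d}$ as $d\to\infty$. 3. Let $\mu_{\rm Haar}$ be the law of $U|0\rangle$ for a Haar-random $U\in U(d)$, where $|0\rangle$ is a fixed basis vector, and let $(|a\rangle)_{a}$ be any orthonormal basis of $\mathbb C^d$. A strategy is a family of measurable functions $p(a|\psi)$ with $p(a|\psi)\ge0$ and $\sum_a p(a|\psi)=1$ for almost every $\psi$. Its overlap for the outcome $a$ is $\int p(a|\psi)\,|\langle a|\psi\rangle|^2\,d\mu_{\rm Haar}(\psi)$. The closest-eigenstate strategy, $p^\star(a|\psi)=1$ if $|\langle a|\psi\rangle|^2>|\langle a'|\psi\rangle|^2$ for all $a'\ne a$ and $p^\star(a|\psi)=0$ otherwise, is a strategy, and its overlap is $H_d/d^2$ for every outcome $a$. For every strategy the average of the overlaps over the $d$ outcomes is at most $H_d/d^2$. In particular, $H_d/d^2$ is the largest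 overlap that a strategy can produce for all outcomes simultaneously. 4. Let $\tilde\psi=\frac1{\sqrt d}\sum_{j}z_j|j\rangle$, where the $z_j$ are independent standard complex Gaussian variables with joint density $\pi^{-d}e^{-\sum_j|z_j|^2}$ on $\mathbb C^d$. Then the direction $\tilde\psi/\|\tilde\psi\|$ has the law $\mu_{\rm Haar}$ and is independent of the norm $\|\tilde\psi\|$. Moreover $\mathbb E\big[p^\star(a|\tilde\psi)\,|\langle a|\tilde\psi\rangle|^2\big]=H_d/d^2$ for every orthonormal basis $(|a\rangle)_a$ and every $a$. -/

import Mathlib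

open MeasureTheory Filter Asymptotics
open scoped Kronecker ComplexOrder

universe u

noncomputable section

/-! ### States and projective measurements -/

/-- Density matrices (quantum states) on `ℂ^n`. -/
def IsDensityMatrix {n : Type*} [Fintype n] (ρ : Matrix n n ℂ) : Prop :=
  ρ.PosSemidef ∧ ρ.trace = 1

/-- An observable, that is, a projective measurement: a Hermitian matrix. -/
abbrev Observable (n : Type*) : Type _ := {A : Matrix n n ℂ // A.IsHermitian}

/-- The set `λ(A)` of possible results of a measurement of `A`: its eigenvalues. -/
def Observable.outcomes {n : Type*} [Fintype n] [DecidableEq n] (A : Observable n) : Finset ℝ :=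
  Finset.univ.image A.2.eigenvalues

/-- The projector `Π_a^A` onto the eigenspace of `A` for the eigenvalue `a`: the sum of
`|v⟩⟨v|` over the eigenvectors `v` with eigenvalue `a` in an orthonormal eigenbasis of `A`. -/
def Observable.proj {n : Type*} [Fintype n] [DecidableEq n] (A : Observable n) (a : ℝ) :
    Matrix n n ℂ :=
  ∑ i with A.2.eigenvalues i = a,
    Matrix.vecMulVec (A.2.eigenvectorBasis i).ofLp (star (A.2.eigenvectorBasis i).ofLp)

/-- The Born probability `Tr[P ρ]` of the projector `P` in the state `ρ`. -/
def bornProb {n : Type*} [Fintype n] (P ρ : Matrix n n ℂ) : ℝ := (P * ρ).trace.re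

/-- The joint probability `P(a, b | A, B; W) = Tr[(Π_a^A ⊗ Π_b^B) W]`. -/
def jointProb {m n : Type*} [Fintype m] [DecidableEq m] [Fintype n] [DecidableEq n]
    (A : Observable m) (a : ℝ) (B : Observable n) (b : ℝ)
    (W : Matrix (m × n) (m × n) ℂ) : ℝ :=
  bornProb (A.proj a ⊗ₖ B.proj b) W

/-! ### Steering -/

/-- A local-hidden-state model for Bob (with Hilbert space `ℂ^n`), correlated with a local
hidden-variable model for Alice (with Hilbert space `ℂ^m`): a random variable `ξ` with
probability law `law`, a local state `ρ_ξ` of Bob, and a stochastic map `℘(a | A, ξ)`. -/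
structure HiddenStateModel (m n : Type) [Fintype m] [DecidableEq m] [Fintype n] where
  /-- the values of the hidden variable -/
  Ξ : Type u
  [measurableSpace : MeasurableSpace Ξ]
  /-- the law of the hidden variable -/
  law : Measure Ξ
  isProbabilityMeasure : IsProbabilityMeasure law
  /-- the local hidden state of Bob -/
  state : Ξ → Matrix n n ℂ
  measurable_state : ∀ i j, Measurable fun ξ => state ξ i j
  isDensityMatrix_state : ∀ ξ, IsDensityMatrix (state ξ)
  /-- `response A a ξ` is the probability that Alice announces `a` when asked to measure `A` -/
  response : Observable m → ℝ → Ξ → ℝ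
  measurable_response : ∀ A, ∀ a ∈ A.outcomes, Measurable (response A a)
  response_nonneg : ∀ A, ∀ a ∈ A.outcomes, ∀ ξ, 0 ≤ response A a ξ
  response_sum : ∀ A ξ, ∑ a ∈ A.outcomes, response A a ξ = 1

attribute [instance] HiddenStateModel.measurableSpace

/-- The model explains the correlations of `W` for the measurements in `M` by Alice and for all
measurements by Bob: `P(a, b | A, B; W) = ∫ ℘(a | A, ξ) P(b | B; ρ_ξ) d℘(ξ)`. -/
def HiddenStateModel.Explains {m n : Type} [Fintype m] [DecidableEq m] [Fintype n]
    [DecidableEq n] (L : HiddenStateModel.{u} m n) (M : Set (Observable m))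
    (W : Matrix (m × n) (m × n) ℂ) : Prop :=
  ∀ A ∈ M, ∀ B : Observable n, ∀ a ∈ A.outcomes, ∀ b ∈ B.outcomes,
    jointProb A a B b W = ∫ ξ, L.response A a ξ * bornProb (B.proj b) (L.state ξ) ∂L.law

/-- Alice's measurement strategy `M` on the state `W` exhibits steering. -/
def ExhibitsSteering {m n : Type} [Fintype m] [DecidableEq m] [Fintype n] [DecidableEq n]
    (M : Set (Observable m)) (W : Matrix (m × n) (m × n) ℂ) : Prop :=
  ¬ ∃ L : HiddenStateModel.{u} m n, L.Explains M W

/-- `W` is steerable (by Alice): some set of projective measurements exhibits steering. -/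
def Steerable {m n : Type} [Fintype m] [DecidableEq m] [Fintype n] [DecidableEq n]
    (W : Matrix (m × n) (m × n) ℂ) : Prop :=
  ∃ M : Set (Observable m), ExhibitsSteering.{u} M W

/-! ### Isotropic states -/

/-- The maximally entangled vector `ψ₊ = ∑ i, |i⟩|i⟩ / √d`. -/
def maxEntangled (d : ℕ) : Fin d × Fin d → ℂ :=
  fun x => if x.1 = x.2 then ((1 / √(d : ℝ) : ℝ) : ℂ) else 0

/-- The isotropic matrix `W_d^η = (1 - η) I / d² + η |ψ₊⟩⟨ψ₊|`. -/
def isotropic (d : ℕ) (η : ℝ) : Matrix (Fin d × Fin d) (Fin d × Fin d) ℂ :=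
  (((1 - η) / (d : ℝ) ^ 2 : ℝ) : ℂ) • (1 : Matrix (Fin d × Fin d) (Fin d × Fin d) ℂ) +
    (η : ℂ) • Matrix.vecMulVec (maxEntangled d) (star (maxEntangled d))

/-! ### The Haar ensemble and its Gaussian representation -/

instance unitaryGroupMeasurableSpace (d : ℕ) :
    MeasurableSpace (Matrix.unitaryGroup (Fin d) ℂ) := borel _

instance unitaryGroupBorelSpace (d : ℕ) : BorelSpace (Matrix.unitaryGroup (Fin d) ℂ) := ⟨rfl⟩

instance unitaryGroupCompactSpace (d : ℕ) : CompactSpace (Matrix.unitaryGroup (Fin d) ℂ) := by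
  have hclosed : IsClosed {U : Matrix (Fin d) (Fin d) ℂ | U ∈ Matrix.unitaryGroup (Fin d) ℂ} := by
    have h : {U : Matrix (Fin d) (Fin d) ℂ | U ∈ Matrix.unitaryGroup (Fin d) ℂ} =
        {U | U * star U = 1} := by
      ext U
      exact Matrix.mem_unitaryGroup_iff
    rw [h]
    exact isClosed_eq (by fun_prop) continuous_const
  have hK : IsCompact (Set.univ.pi fun _ : Fin d => Set.univ.pi fun _ : Fin d =>
      Metric.closedBall (0 : ℂ) 1) :=
    isCompact_univ_pi fun _ => isCompact_univ_pi fun _ => isCompact_closedBall _ _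
  refine isCompact_iff_compactSpace.1 (hK.of_isClosed_subset hclosed ?_)
  intro U hU i _ j _
  simpa using entry_norm_bound_of_unitary hU i j

/-- The law of a Haar-random pure state: the law of `U|0⟩` for `U` distributed according to the
Haar probability measure of the unitary group `U(d)`. -/
def haarState (d : ℕ) [NeZero d] : Measure (EuclideanSpace ℂ (Fin d)) :=
  (Measure.haarMeasure (⊤ : TopologicalSpace.PositiveCompacts (Matrix.unitaryGroup (Fin d) ℂ))).map
    fun U : Matrix.unitaryGroup (Fin d) ℂ =>
      WithLp.toLp 2 fun i => (U : Matrix (Fin d) (Fin d) ℂ) i 0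

/-- The law of the unnormalized random vector `(1/√d) ∑ j, z_j |j⟩`, where the `z_j` are
independent standard complex Gaussians, of joint density `π^(-d) exp(-∑ j, |z_j|²)`. -/
def gaussianState (d : ℕ) : Measure (EuclideanSpace ℂ (Fin d)) :=
  ((volume : Measure (Fin d → ℂ)).withDensity fun z =>
      ENNReal.ofReal ((Real.pi ^ d)⁻¹ * Real.exp (-∑ j, ‖z j‖ ^ 2))).map
    fun z => WithLp.toLp 2 fun j => z j / ((√(d : ℝ) : ℝ) : ℂ)

/-- `p a ψ` is a (measurable) conditional probability distribution of the outcome `a` given the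
state `ψ`, for almost every `ψ` of the ensemble `μ`. -/
def IsCheatingStrategy {d : ℕ} (μ : Measure (EuclideanSpace ℂ (Fin d)))
    (p : Fin d → EuclideanSpace ℂ (Fin d) → ℝ) : Prop :=
  (∀ a, Measurable (p a)) ∧ ∀ᵐ ψ ∂μ, (∀ a, 0 ≤ p a ψ) ∧ ∑ a, p a ψ = 1

open Classical in
/-- The closest-eigenstate strategy for a measurement in the orthonormal basis `v`: announce `a`
if and only if `|⟨v_a|ψ⟩|²` is strictly larger than all the other `|⟨v_a'|ψ⟩|²`. -/
def closestEigenstate {d : ℕ} (v : OrthonormalBasis (Fin d) ℂ (EuclideanSpace ℂ (Fin d)))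
    (a : Fin d) (ψ : EuclideanSpace ℂ (Fin d)) : ℝ :=
  if ∀ a', a' ≠ a → ‖inner ℂ (v a') ψ‖ ^ 2 < ‖inner ℂ (v a) ψ‖ ^ 2 then 1 else 0

/-- The overlap `⟨v_a| (∫ |ψ⟩⟨ψ| p(a|ψ) dμ(ψ)) |v_a⟩ = ∫ p(a|ψ) |⟨v_a|ψ⟩|² dμ(ψ)`. -/
def overlap {d : ℕ} (μ : Measure (EuclideanSpace ℂ (Fin d)))
    (v : OrthonormalBasis (Fin d) ℂ (EuclideanSpace ℂ (Fin d)))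
    (p : Fin d → EuclideanSpace ℂ (Fin d) → ℝ) (a : Fin d) : ℝ :=
  ∫ ψ, p a ψ * ‖inner ℂ (v a) ψ‖ ^ 2 ∂μ

end

/-! Everything rests on one number, the mean over Haar-random unit vectors of the largest $|x_j|^2$,
which equals $H_d/d$. A Gaussian vector has Haar direction independent of its norm, and the squared
moduli of its unnormalized coordinates are independent standard exponentials. Their maximum has mean
$\int_0^\infty\bigl(1-(1-e^{-s})^d\bigr)\,ds=H_d$, and the factor $1/d$ in $\|\tilde\psi\|^2$ makes
the mean squared norm $1$ (`lintegral_haarState_norm_ofLp_sq`). Since $\sum_a p(a|\psi)|\langle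
a|\psi\rangle|^2$ is at most the largest $|\langle a|\psi\rangle|^2$, with equality for the closest
eigenstate, the claims on overlaps follow; permutation symmetry shares the total equally among the
outcomes.

Existence of models. Let Bob's hidden state be Haar-random and pure, and let Alice answer by a rule
depending only on the moduli of the coordinates in her eigenbasis, equivariantly under permutations.
Sign flips make the resulting ensemble operator diagonal, and permutations make all entries but one
equal, so it is fixed by the overlap $c$ alone (`IsCovariantStrategy.integral_mul_inner_eq`). It
reproduces $W_d^\eta$ exactly when $c=(1-\eta)/d^2+\eta/d$. Convex combinations of two rules give
every $c$ between $1/(d(d+1))$, which corresponds to the least $\eta$ allowed by positivity, and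
$H_d/d^2$, which corresponds to $\eta=(H_d-1)/(d-1)$ (`exists_isCovariantStrategy`).

Optimality. For any model and any basis $w$, adding up the perfectly correlated outcomes of $\bar w$
and $w$ gives $(1-\eta)/d+\eta\le\mathbb E_\xi\max_k\langle w_k|\rho_\xi|w_k\rangle$. Averaging over
Haar-random $w$ and exchanging the integrals bounds the right side by $H_d/d$, because the maximum
is convex in $\rho_\xi$ and pure states attain exactly this mean
(`HiddenStateModel.Explains.parameter_le`). Alice's responses disappear before the averaging, so
their dependence on the basis needs no measurability. -/

/-! ### The unitary group acting on `ℂ^d` and the law of a Haar-random state -/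

/-- The action of a unitary matrix on `ℂ^d`. -/
noncomputable def unitaryAct {d : ℕ} (U : Matrix.unitaryGroup (Fin d) ℂ)
    (x : EuclideanSpace ℂ (Fin d)) : EuclideanSpace ℂ (Fin d) :=
  WithLp.toLp 2 (Matrix.mulVec (U : Matrix (Fin d) (Fin d) ℂ) x.ofLp)

lemma unitaryAct_mul {d : ℕ} (U V : Matrix.unitaryGroup (Fin d) ℂ)
    (x : EuclideanSpace ℂ (Fin d)) : unitaryAct (U * V) x = unitaryAct U (unitaryAct V x) := by
  simp [unitaryAct]

lemma unitaryAct_one {d : ℕ} (x : EuclideanSpace ℂ (Fin d)) : unitaryAct 1 x = x := by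
  simp [unitaryAct]

lemma unitaryAct_smul {d : ℕ} (U : Matrix.unitaryGroup (Fin d) ℂ) (c : ℂ)
    (x : EuclideanSpace ℂ (Fin d)) : unitaryAct U (c • x) = c • unitaryAct U x := by
  simp [unitaryAct, Matrix.mulVec_smul]

lemma unitaryAct_single {d : ℕ} (U : Matrix.unitaryGroup (Fin d) ℂ) (i : Fin d) :
    unitaryAct U (EuclideanSpace.single i 1) =
      WithLp.toLp 2 fun j => (U : Matrix (Fin d) (Fin d) ℂ) j i := by
  ext j
  simp [unitaryAct]

lemma inner_unitaryAct {d : ℕ} (U : Matrix.unitaryGroup (Fin d) ℂ)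
    (x y : EuclideanSpace ℂ (Fin d)) :
    inner ℂ (unitaryAct U x) y = inner ℂ x (unitaryAct U⁻¹ y) := by
  simp only [unitaryAct, EuclideanSpace.inner_eq_star_dotProduct, Matrix.star_mulVec]
  rw [dotProduct_comm, ← Matrix.dotProduct_mulVec, dotProduct_comm]
  rfl

lemma unitaryAct_inv_act {d : ℕ} (U : Matrix.unitaryGroup (Fin d) ℂ)
    (x : EuclideanSpace ℂ (Fin d)) : unitaryAct U⁻¹ (unitaryAct U x) = x := by
  rw [← unitaryAct_mul, inv_mul_cancel, unitaryAct_one]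

lemma inner_unitaryAct_unitaryAct {d : ℕ} (U : Matrix.unitaryGroup (Fin d) ℂ)
    (x y : EuclideanSpace ℂ (Fin d)) :
    inner ℂ (unitaryAct U x) (unitaryAct U y) = inner ℂ x y := by
  rw [inner_unitaryAct, unitaryAct_inv_act]

lemma norm_unitaryAct {d : ℕ} (U : Matrix.unitaryGroup (Fin d) ℂ)
    (x : EuclideanSpace ℂ (Fin d)) : ‖unitaryAct U x‖ = ‖x‖ := by
  rw [@norm_eq_sqrt_re_inner ℂ, @norm_eq_sqrt_re_inner ℂ _ _ _ _ x, inner_unitaryAct_unitaryAct]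

lemma continuous_unitaryAct_left {d : ℕ} (x : EuclideanSpace ℂ (Fin d)) :
    Continuous fun U : Matrix.unitaryGroup (Fin d) ℂ => unitaryAct U x := by
  unfold unitaryAct
  fun_prop

lemma measurable_unitaryGroup_entry {d : ℕ} (i j : Fin d) :
    Measurable fun U : Matrix.unitaryGroup (Fin d) ℂ => (U : Matrix (Fin d) (Fin d) ℂ) i j :=
  (continuous_subtype_val.matrix_elem i j).measurable

lemma measurable_unitaryAct {d : ℕ} :
    Measurable fun p : Matrix.unitaryGroup (Fin d) ℂ × EuclideanSpace ℂ (Fin d) =>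
      unitaryAct p.1 p.2 := by
  refine (WithLp.measurable_toLp 2 _).comp (measurable_pi_lambda _ fun i => ?_)
  change Measurable fun p : Matrix.unitaryGroup (Fin d) ℂ × EuclideanSpace ℂ (Fin d) =>
    ∑ j, (p.1 : Matrix (Fin d) (Fin d) ℂ) i j * p.2 j
  refine Finset.measurable_fun_sum _ fun j _ => ?_
  refine ((measurable_unitaryGroup_entry i j).comp measurable_fst).mul ?_
  have : Measurable fun x : EuclideanSpace ℂ (Fin d) => x j :=
    Continuous.measurable (by fun_prop)
  exact this.comp measurable_snd

lemma exists_unitaryAct_eq {d : ℕ} (L : EuclideanSpace ℂ (Fin d) ≃ₗᵢ[ℂ] EuclideanSpace ℂ (Fin d)) :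
    ∃ U : Matrix.unitaryGroup (Fin d) ℂ, ∀ x, unitaryAct U x = L x := by
  let b := EuclideanSpace.basisFun (Fin d) ℂ
  refine ⟨⟨_, L.toMatrix_mem_unitaryGroup b b⟩, fun x => ?_⟩
  ext i
  have := congrFun (LinearMap.toMatrix_mulVec_repr b.toBasis b.toBasis
    (L.toLinearEquiv : EuclideanSpace ℂ (Fin d) →ₗ[ℂ] EuclideanSpace ℂ (Fin d)) x) i
  simpa [b] using! this

lemma exists_orthonormalBasis_apply_eq {d : ℕ} (i : Fin d) {x : EuclideanSpace ℂ (Fin d)}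
    (hx : ‖x‖ = 1) : ∃ b : OrthonormalBasis (Fin d) ℂ (EuclideanSpace ℂ (Fin d)), b i = x := by
  obtain ⟨b, hb⟩ := Orthonormal.exists_orthonormalBasis_extension_of_card_eq (𝕜 := ℂ)
    (E := EuclideanSpace ℂ (Fin d)) (ι := Fin d) (v := fun _ => x) (s := {i}) (by simp) (by
      constructor
      · intro j; simpa using hx
      · intro j k hjk; exact absurd (Subsingleton.elim j k) hjk)
  exact ⟨b, hb i rfl⟩

lemma exists_unitaryAct_single_eq {d : ℕ} (i : Fin d) {x : EuclideanSpace ℂ (Fin d)}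
    (hx : ‖x‖ = 1) :
    ∃ U : Matrix.unitaryGroup (Fin d) ℂ, unitaryAct U (EuclideanSpace.single i 1) = x := by
  obtain ⟨b, hb⟩ := exists_orthonormalBasis_apply_eq i hx
  obtain ⟨U, hU⟩ := exists_unitaryAct_eq b.repr.symm
  refine ⟨U, ?_⟩
  rw [hU, OrthonormalBasis.repr_symm_single]
  exact hb

/-- The Haar probability measure of the unitary group `U(d)`. -/
noncomputable def haarUnitary (d : ℕ) : Measure (Matrix.unitaryGroup (Fin d) ℂ) :=
  Measure.haarMeasure (⊤ : TopologicalSpace.PositiveCompacts (Matrix.unitaryGroup (Fin d) ℂ))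

instance (d : ℕ) : IsProbabilityMeasure (haarUnitary d) :=
  ⟨Measure.haarMeasure_self⟩

instance (d : ℕ) : (haarUnitary d).IsHaarMeasure := by
  unfold haarUnitary; infer_instance

/-- Left and right translations commute, so a right translate of Haar measure is again left
invariant, hence a multiple of it; the total mass fixes the factor at one. -/
lemma haarUnitary_map_mul_right {d : ℕ} (V : Matrix.unitaryGroup (Fin d) ℂ) :
    (haarUnitary d).map (fun U => U * V) = haarUnitary d := by
  have hp : IsProbabilityMeasure ((haarUnitary d).map (fun U => U * V)) :=
    Measure.isProbabilityMeasure_map (measurable_mul_const V).aemeasurable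
  have h := Measure.isMulInvariant_eq_smul_of_compactSpace
    ((haarUnitary d).map (fun U => U * V)) (haarUnitary d)
  have h1 := congrArg (fun m => m Set.univ) h
  simp only [measure_univ, Measure.smul_apply, ENNReal.smul_def, smul_eq_mul, mul_one] at h1
  rw [h, ENNReal.coe_eq_one.1 h1.symm, one_smul]

lemma haarState_eq_map_single (d : ℕ) [NeZero d] :
    haarState d = (haarUnitary d).map fun U => unitaryAct U (EuclideanSpace.single 0 1) := by
  simp only [unitaryAct_single]; rfl

/-- The unitary group is transitive on the unit sphere: with $x=V|0\rangle$, right invariance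
absorbs $V$. -/
lemma map_unitaryAct_haarUnitary {d : ℕ} [NeZero d] {x : EuclideanSpace ℂ (Fin d)}
    (hx : ‖x‖ = 1) : (haarUnitary d).map (fun U => unitaryAct U x) = haarState d := by
  obtain ⟨V, hV⟩ := exists_unitaryAct_single_eq 0 hx
  rw [haarState_eq_map_single]
  conv_rhs => rw [← haarUnitary_map_mul_right V]
  rw [Measure.map_map (continuous_unitaryAct_left _).measurable (measurable_mul_const V)]
  congr 1
  ext1 U
  rw [Function.comp_apply, unitaryAct_mul, hV]

instance (d : ℕ) [NeZero d] : IsProbabilityMeasure (haarState d) := by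
  rw [haarState_eq_map_single]
  exact Measure.isProbabilityMeasure_map (continuous_unitaryAct_left _).measurable.aemeasurable

lemma haarState_ae_norm_eq_one (d : ℕ) [NeZero d] : ∀ᵐ ψ ∂haarState d, ‖ψ‖ = 1 := by
  rw [haarState_eq_map_single, ae_map_iff (continuous_unitaryAct_left _).measurable.aemeasurable
    (measurableSet_eq_fun measurable_norm measurable_const)]
  exact Eventually.of_forall fun U => by simp [norm_unitaryAct]

/-- The Haar ensemble is invariant under unitary maps. -/
lemma haarState_map_linearIsometryEquiv {d : ℕ} [NeZero d]
    (L : EuclideanSpace ℂ (Fin d) ≃ₗᵢ[ℂ] EuclideanSpace ℂ (Fin d)) :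
    (haarState d).map L = haarState d := by
  obtain ⟨V, hV⟩ := exists_unitaryAct_eq L
  rw [haarState_eq_map_single, Measure.map_map L.continuous.measurable
    (continuous_unitaryAct_left _).measurable]
  conv_rhs => rw [← map_mul_left_eq_self (haarUnitary d) V]
  rw [Measure.map_map (continuous_unitaryAct_left _).measurable (measurable_const_mul V)]
  congr 1
  ext1 U
  simp only [Function.comp_apply, unitaryAct_mul, hV]

/-! ### Complex Gaussian vectors -/

/-- The law of a standard complex Gaussian variable. -/
noncomputable def complexGaussian : Measure ℂ :=
  (volume : Measure ℂ).withDensity fun z => ENNReal.ofReal (Real.pi⁻¹ * Real.exp (-‖z‖ ^ 2))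

lemma lintegral_expMeasure_one {f : ℝ → ENNReal} (hf : Measurable f) :
    ∫⁻ t, f t ∂ProbabilityTheory.expMeasure 1 =
      ∫⁻ t in Set.Ioi 0, ENNReal.ofReal (Real.exp (-t)) * f t := by
  have h : ProbabilityTheory.gammaPDF 1 1 =
      (Set.Ici 0).indicator fun t => ENNReal.ofReal (Real.exp (-t)) := by
    ext1 t
    by_cases ht : 0 ≤ t <;>
    simp [ProbabilityTheory.gammaPDF, ProbabilityTheory.gammaPDFReal, ht]
  unfold ProbabilityTheory.expMeasure ProbabilityTheory.gammaMeasure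
  rw [h, lintegral_withDensity_eq_lintegral_mul _
      (Measurable.indicator (by fun_prop) measurableSet_Ici) hf,
    setLIntegral_congr (μ := volume) Ioi_ae_eq_Ici, ← lintegral_indicator measurableSet_Ici]
  refine lintegral_congr fun t => ?_
  rw [Pi.mul_apply, Set.indicator_mul_left]

/-- Polar coordinates: the angle contributes $2\pi$ against the constant $\pi^{-1}$, leaving
$2r\,e^{-r^2}dr$, which is $e^{-t}dt$ for $t=r^2$. -/
lemma lintegral_complexGaussian_norm_sq {f : ℝ → ENNReal} (hf : Measurable f) :
    ∫⁻ z, f (‖z‖ ^ 2) ∂complexGaussian =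
      ∫⁻ t in Set.Ioi 0, ENNReal.ofReal (Real.exp (-t)) * f t := by
  have hsub : ∫⁻ t in Set.Ioi (0 : ℝ), ENNReal.ofReal (Real.exp (-t)) * f t =
      ∫⁻ r in Set.Ioi (0 : ℝ), ENNReal.ofReal |2 * r| *
        (ENNReal.ofReal (Real.exp (-r ^ 2)) * f (r ^ 2)) := by
    have himage : (fun r : ℝ => r ^ 2) '' Set.Ioi 0 = Set.Ioi 0 := by
      ext t
      constructor
      · rintro ⟨r, hr, rfl⟩
        exact pow_pos (Set.mem_Ioi.1 hr) 2
      · intro ht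
        exact ⟨√t, Real.sqrt_pos.2 ht, Real.sq_sqrt (le_of_lt ht)⟩
    conv_lhs => rw [← himage]
    refine lintegral_image_eq_lintegral_abs_deriv_mul measurableSet_Ioi
      (fun r _ => ?_) ?_ _
    · simpa using (hasDerivAt_pow 2 r).hasDerivWithinAt
    · intro r hr s hs h
      exact (pow_left_inj₀ (le_of_lt hr) (le_of_lt hs) two_ne_zero).1 h
  unfold complexGaussian
  rw [lintegral_withDensity_eq_lintegral_mul _ (by fun_prop) (by fun_prop),
    ← Complex.lintegral_comp_polarCoord_symm, hsub]
  have htarget : polarCoord.target = Set.Ioi (0 : ℝ) ×ˢ Set.Ioo (-Real.pi) Real.pi := rfl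
  rw [htarget, Measure.volume_eq_prod, ← Measure.prod_restrict]
  simp only [Pi.mul_apply, Complex.norm_polarCoord_symm, sq_abs, smul_eq_mul]
  rw [lintegral_prod _ (by fun_prop)]
  simp only [lintegral_const, Measure.restrict_apply_univ, Real.volume_Ioo]
  refine setLIntegral_congr_fun measurableSet_Ioi fun r hr => ?_
  have hr : 0 < r := hr
  have hpi := Real.pi_pos
  rw [show Real.pi - -Real.pi = 2 * Real.pi by ring, mul_right_comm, ← mul_assoc, ← mul_assoc,
    abs_of_pos (by positivity),
    ← ENNReal.ofReal_mul (by positivity), ← ENNReal.ofReal_mul (by positivity),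
    ← ENNReal.ofReal_mul (by positivity)]
  congr 2
  field_simp

lemma complexGaussian_map_norm_sq :
    complexGaussian.map (fun z => ‖z‖ ^ 2) = ProbabilityTheory.expMeasure 1 := by
  refine Measure.ext_of_lintegral _ fun f hf => ?_
  rw [lintegral_map hf (by fun_prop), lintegral_complexGaussian_norm_sq hf,
    lintegral_expMeasure_one hf]

instance : IsProbabilityMeasure (ProbabilityTheory.expMeasure 1) :=
  ProbabilityTheory.isProbabilityMeasure_expMeasure one_pos

instance : IsProbabilityMeasure complexGaussian := by
  constructor
  have h := congrArg (fun m => m Set.univ) complexGaussian_map_norm_sq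
  simpa [Measure.map_apply (show Measurable fun z : ℂ => ‖z‖ ^ 2 by fun_prop)
    MeasurableSet.univ] using h

lemma pi_complexGaussian (d : ℕ) :
    Measure.pi (fun _ : Fin d => complexGaussian) =
      (volume : Measure (Fin d → ℂ)).withDensity fun z =>
        ENNReal.ofReal ((Real.pi ^ d)⁻¹ * Real.exp (-∑ j, ‖z j‖ ^ 2)) := by
  -- Integrability of the density is read off from the finite total mass, already known through the
  -- exponential law of $|z|^2$.
  have hint : Integrable (fun z : ℂ => Real.pi⁻¹ * Real.exp (-‖z‖ ^ 2)) := by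
    refine ⟨by fun_prop, ?_⟩
    rw [hasFiniteIntegral_iff_ofReal (Eventually.of_forall fun z => by positivity)]
    have h : complexGaussian Set.univ < ⊤ := measure_lt_top _ _
    simpa [complexGaussian] using h
  refine Measure.pi_eq fun s hs => ?_
  rw [withDensity_apply _ (MeasurableSet.univ_pi hs), volume_pi, Measure.restrict_pi_pi]
  have hprod : ∀ z : Fin d → ℂ, (Real.pi ^ d)⁻¹ * Real.exp (-∑ j, ‖z j‖ ^ 2) =
      ∏ j, Real.pi⁻¹ * Real.exp (-‖z j‖ ^ 2) := by
    intro z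
    rw [Finset.prod_mul_distrib, ← Real.exp_sum]
    simp
  simp only [hprod]
  rw [← ofReal_integral_eq_lintegral_ofReal]
  · rw [integral_fintype_prod_eq_prod (fun (_ : Fin d) (z : ℂ) => Real.pi⁻¹ * Real.exp (-‖z‖ ^ 2)),
      ENNReal.ofReal_prod_of_nonneg]
    · refine Finset.prod_congr rfl fun i _ => ?_
      rw [complexGaussian, withDensity_apply _ (hs i), ofReal_integral_eq_lintegral_ofReal]
      · exact hint.integrableOn
      · exact Eventually.of_forall fun z => by positivity
    · exact fun i _ => integral_nonneg fun z => by positivity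
  · exact Integrable.fintype_prod fun i => hint.integrableOn
  · exact Eventually.of_forall fun z => Finset.prod_nonneg fun i _ => by positivity

lemma gaussianState_eq_map_pi (d : ℕ) :
    gaussianState d = (Measure.pi fun _ : Fin d => complexGaussian).map
      fun z => WithLp.toLp 2 fun j => z j / ((√(d : ℝ) : ℝ) : ℂ) := by
  rw [pi_complexGaussian]; rfl

lemma measurable_toLp_div {d : ℕ} (c : ℂ) :
    Measurable fun z : Fin d → ℂ => (WithLp.toLp 2 fun j => z j / c : EuclideanSpace ℂ (Fin d)) :=
  (WithLp.measurable_toLp 2 _).comp (by fun_prop)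

instance (d : ℕ) : IsProbabilityMeasure (gaussianState d) := by
  rw [gaussianState_eq_map_pi]
  exact Measure.isProbabilityMeasure_map (measurable_toLp_div _).aemeasurable

lemma pi_complexGaussian_map_norm_sq (d : ℕ) :
    (Measure.pi fun _ : Fin d => complexGaussian).map (fun z j => ‖z j‖ ^ 2) =
      Measure.pi fun _ : Fin d => ProbabilityTheory.expMeasure 1 := by
  rw [← complexGaussian_map_norm_sq]
  have : ∀ i : Fin d, SigmaFinite (complexGaussian.map fun z => ‖z‖ ^ 2) := fun _ => by
    rw [complexGaussian_map_norm_sq]; infer_instance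
  exact Measure.pi_map_pi (μ := fun _ : Fin d => complexGaussian) (f := fun _ z => ‖z‖ ^ 2)
    fun _ => by fun_prop

/-! ### The maximum of independent exponential variables -/

/-- Balls serve better than half-lines here because a ball of the sup norm on `Fin d → ℝ` is a
product of them; the law lives on positive reals, so both have the same mass. -/
lemma expMeasure_closedBall (s : ℝ) :
    ProbabilityTheory.expMeasure 1 (Metric.closedBall 0 s) =
      ENNReal.ofReal (if 0 ≤ s then 1 - Real.exp (-s) else 0) := by
  have h : ProbabilityTheory.expMeasure 1 (Metric.closedBall 0 s) =
      ProbabilityTheory.expMeasure 1 (Set.Iic s) := by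
    rw [← lintegral_indicator_one measurableSet_closedBall,
      ← lintegral_indicator_one measurableSet_Iic,
      lintegral_expMeasure_one (measurable_one.indicator measurableSet_closedBall),
      lintegral_expMeasure_one (measurable_one.indicator measurableSet_Iic)]
    refine setLIntegral_congr_fun measurableSet_Ioi fun t ht => ?_
    have ht : 0 < t := ht
    have hiff : t ∈ Metric.closedBall 0 s ↔ t ∈ Set.Iic s := by simp [abs_of_pos ht]
    by_cases h : t ∈ Set.Iic s
    · simp [Set.indicator_of_mem h, Set.indicator_of_mem (hiff.2 h)]
    · simp [Set.indicator_of_notMem h, Set.indicator_of_notMem (mt hiff.1 h)]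
  rw [h, ← ProbabilityTheory.ofReal_cdf, ProbabilityTheory.cdf_expMeasure_eq one_pos, one_mul]

/-- With $u=1-e^{-s}$ one has $u'=1-u$, so the derivative is $(1-u)\sum_{k<d}u^k=1-u^d$. This gives
an antiderivative of the tail of the maximum, vanishing at $0$ and tending to $H_d$. -/
lemma hasDerivAt_sum_one_sub_exp (d : ℕ) (s : ℝ) :
    HasDerivAt (fun s : ℝ => ∑ k ∈ Finset.range d, (1 - Real.exp (-s)) ^ (k + 1) / ((k : ℝ) + 1))
      (1 - (1 - Real.exp (-s)) ^ d) s := by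
  have h1 : HasDerivAt (fun s : ℝ => 1 - Real.exp (-s)) (Real.exp (-s)) s := by
    simpa using ((hasDerivAt_neg s).exp).const_sub 1
  have h2 := HasDerivAt.fun_sum (u := Finset.range d) fun k _ =>
    (h1.pow (k + 1)).div_const ((k : ℝ) + 1)
  refine h2.congr_deriv ?_
  have h3 := mul_neg_geom_sum (1 - Real.exp (-s)) d
  rw [← h3, Finset.mul_sum]
  refine Finset.sum_congr rfl fun k _ => ?_
  have : (k : ℝ) + 1 ≠ 0 := by positivity
  push_cast
  field_simp
  simp [mul_comm]

lemma tendsto_sum_one_sub_exp (d : ℕ) :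
    Tendsto (fun s : ℝ => ∑ k ∈ Finset.range d, (1 - Real.exp (-s)) ^ (k + 1) / ((k : ℝ) + 1))
      atTop (nhds (harmonic d : ℝ)) := by
  have h1 : Tendsto (fun s : ℝ => 1 - Real.exp (-s)) atTop (nhds 1) := by
    simpa using Real.tendsto_exp_neg_atTop_nhds_zero.const_sub 1
  have h2 := tendsto_finsetSum (Finset.range d) fun k _ =>
    (h1.pow (k + 1)).div_const ((k : ℝ) + 1)
  simpa [harmonic] using h2

lemma lintegral_one_sub_exp_pow (d : ℕ) :
    ∫⁻ s in Set.Ioi (0 : ℝ), ENNReal.ofReal (1 - (1 - Real.exp (-s)) ^ d) =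
      ENNReal.ofReal (harmonic d : ℝ) := by
  have hnonneg : ∀ s ∈ Set.Ioi (0 : ℝ), 0 ≤ 1 - (1 - Real.exp (-s)) ^ d := by
    intro s hs
    have h1 : Real.exp (-s) ≤ 1 := Real.exp_le_one_iff.2 (by simpa using le_of_lt hs)
    have h2 : (1 - Real.exp (-s)) ^ d ≤ 1 :=
      pow_le_one₀ (by linarith) (by linarith [Real.exp_pos (-s)])
    linarith
  rw [← ofReal_integral_eq_lintegral_ofReal
    (integrableOn_Ioi_deriv_of_nonneg' (fun s _ => hasDerivAt_sum_one_sub_exp d s) hnonneg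
      (tendsto_sum_one_sub_exp d))
    ((ae_restrict_iff' measurableSet_Ioi).2 (Eventually.of_forall hnonneg)),
    integral_Ioi_of_hasDerivAt_of_nonneg' (fun s _ => hasDerivAt_sum_one_sub_exp d s) hnonneg
      (tendsto_sum_one_sub_exp d)]
  simp

/-- The expected maximum of `d` independent standard exponential variables is `H_d`. -/
lemma lintegral_pi_expMeasure_norm (d : ℕ) :
    ∫⁻ t, ENNReal.ofReal ‖t‖ ∂(Measure.pi fun _ : Fin d => ProbabilityTheory.expMeasure 1) =
      ENNReal.ofReal (harmonic d : ℝ) := by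
  -- Layer-cake formula: the mean is the integral of the tail, and the complement of the tail event
  -- is a product of one-dimensional balls.
  rw [lintegral_eq_lintegral_meas_lt _ (Eventually.of_forall fun t => norm_nonneg t)
    (by fun_prop), ← lintegral_one_sub_exp_pow]
  refine setLIntegral_congr_fun measurableSet_Ioi fun s hs => ?_
  have hs : 0 < s := hs
  have hexp : Real.exp (-s) ≤ 1 := Real.exp_le_one_iff.2 (by linarith)
  have hcompl : {t : Fin d → ℝ | s < ‖t‖} = (Metric.closedBall 0 s)ᶜ := by
    ext t; simp
  rw [hcompl, prob_compl_eq_one_sub measurableSet_closedBall, closedBall_pi _ hs.le,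
    Measure.pi_pi]
  simp only [Pi.zero_apply, expMeasure_closedBall, if_pos hs.le]
  rw [Finset.prod_const, Finset.card_univ, Fintype.card_fin,
    ← ENNReal.ofReal_pow (by linarith), ← ENNReal.ofReal_one,
    ← ENNReal.ofReal_sub _ (pow_nonneg (by linarith) _)]

/-- The mean of one exponential variable is the case $d=1$ of the mean maximum, where $H_1=1$. -/
lemma lintegral_expMeasure_ofReal :
    ∫⁻ t, ENNReal.ofReal |t| ∂ProbabilityTheory.expMeasure 1 = 1 := by
  have h := lintegral_pi_expMeasure_norm 1
  have hmp := measurePreserving_eval (fun _ : Fin 1 => ProbabilityTheory.expMeasure 1) 0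
  rw [← hmp.lintegral_comp (by fun_prop)]
  have hnorm : ∀ t : Fin 1 → ℝ, ‖t‖ = |t 0| := fun t => by
    rw [Pi.norm_def]; simp
  simpa [hnorm] using h

/-- The pair of coordinates has law $\mu\otimes\mu$, and every section of the diagonal is a single
point, hence null. -/
lemma pi_ae_ne {ι X : Type*} [Fintype ι] [MeasurableSpace X] [MeasurableEq X]
    (μ : Measure X) [IsProbabilityMeasure μ] (hμ : ∀ x, μ {x} = 0) {i j : ι} (hij : i ≠ j) :
    ∀ᵐ t ∂(Measure.pi fun _ : ι => μ), t i ≠ t j := by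
  classical
  have hind := (ProbabilityTheory.iIndepFun_pi (μ := fun _ : ι => μ) (X := fun _ x => x)
    (fun _ => aemeasurable_id)).indepFun hij
  have hlaw := (ProbabilityTheory.indepFun_iff_map_prod_eq_prod_map_map
    (measurable_pi_apply i).aemeasurable (measurable_pi_apply j).aemeasurable).1 hind
  have heval : ∀ i, (Measure.pi fun _ : ι => μ).map (fun t => t i) = μ := fun i =>
    (measurePreserving_eval (fun _ : ι => μ) i).map_eq
  rw [heval, heval] at hlaw
  have hdiag : (μ.prod μ) (Set.diagonal X) = 0 := by
    rw [Measure.measure_prod_null measurableSet_diagonal]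
    refine Eventually.of_forall fun x => ?_
    have : Prod.mk x ⁻¹' Set.diagonal X = {x} := by
      ext y; simp [eq_comm]
    simp [this, hμ]
  rw [← hlaw, Measure.map_apply (by fun_prop) measurableSet_diagonal] at hdiag
  exact measure_eq_zero_iff_ae_notMem.1 hdiag

lemma expMeasure_singleton (x : ℝ) : ProbabilityTheory.expMeasure 1 {x} = 0 :=
  withDensity_absolutelyContinuous _ _ (measure_singleton x)

/-! ### Unitary invariance of the Gaussian ensemble and its relation to the Haar ensemble -/

/-- The image is a translation-invariant multiple of `m`; the factor is one because an isometry
preserves the unit ball, whose mass is positive and finite. -/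
lemma isAddHaarMeasure_map_linearIsometryEquiv {E : Type*} [NormedAddCommGroup E]
    [NormedSpace ℝ E] [FiniteDimensional ℝ E] [MeasurableSpace E] [BorelSpace E]
    (m : Measure E) [m.IsAddHaarMeasure] (L : E ≃ₗᵢ[ℝ] E) : m.map L = m := by
  have hL : (m.map L).IsAddHaarMeasure :=
    L.toContinuousLinearEquiv.isAddHaarMeasure_map m
  have h := Measure.isAddLeftInvariant_eq_smul (m.map L) m
  have hball : m.map L (Metric.ball 0 1) = m (Metric.ball 0 1) := by
    rw [Measure.map_apply L.continuous.measurable Metric.isOpen_ball.measurableSet]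
    congr 1
    ext x
    simp
  have hpos : m (Metric.ball 0 1) ≠ 0 := (Metric.measure_ball_pos m 0 one_pos).ne'
  have hfin : m (Metric.ball 0 1) ≠ ⊤ := measure_ball_lt_top.ne
  rw [h, Measure.smul_apply, ENNReal.smul_def, smul_eq_mul,
    ENNReal.mul_eq_right hpos hfin] at hball
  rw [h, ENNReal.coe_eq_one.1 hball, one_smul]

/-- The Lebesgue measure of `ℂ^d`. -/
noncomputable def euclideanLebesgue (d : ℕ) : Measure (EuclideanSpace ℂ (Fin d)) :=
  (volume : Measure (Fin d → ℂ)).map (WithLp.toLp 2)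

instance (d : ℕ) : (euclideanLebesgue d).IsAddHaarMeasure :=
  ((PiLp.continuousLinearEquiv 2 ℝ fun _ : Fin d => ℂ).symm).isAddHaarMeasure_map volume

/-- In this form the density depends on the Euclidean norm only, which makes unitary invariance
visible. -/
lemma gaussianState_eq_map_withDensity (d : ℕ) :
    gaussianState d = ((euclideanLebesgue d).withDensity fun x =>
      ENNReal.ofReal ((Real.pi ^ d)⁻¹ * Real.exp (-‖x‖ ^ 2))).map
        fun x => (((√(d : ℝ) : ℝ) : ℂ))⁻¹ • x := by
  refine Measure.ext_of_lintegral _ fun f hf => ?_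
  have h1 : Measurable fun z : Fin d → ℂ =>
      f (WithLp.toLp 2 fun j => z j / ((√(d : ℝ) : ℝ) : ℂ)) := hf.comp (measurable_toLp_div _)
  have h2 : Measurable fun x : EuclideanSpace ℂ (Fin d) =>
      f ((((√(d : ℝ) : ℝ) : ℂ))⁻¹ • x) := hf.comp (measurable_const_smul _)
  rw [gaussianState, lintegral_map hf (measurable_toLp_div _),
    lintegral_map hf (measurable_const_smul _),
    lintegral_withDensity_eq_lintegral_mul _ (by fun_prop) h1,
    lintegral_withDensity_eq_lintegral_mul _ (by fun_prop) h2, euclideanLebesgue,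
    lintegral_map (by fun_prop) (WithLp.measurable_toLp 2 _)]
  refine lintegral_congr fun z => ?_
  simp only [Pi.mul_apply, EuclideanSpace.norm_sq_eq]
  congr 2
  ext j
  simp [div_eq_inv_mul]

/-- The Gaussian ensemble is invariant under unitary maps. -/
lemma gaussianState_map_linearIsometryEquiv {d : ℕ}
    (L : EuclideanSpace ℂ (Fin d) ≃ₗᵢ[ℂ] EuclideanSpace ℂ (Fin d)) :
    (gaussianState d).map L = gaussianState d := by
  have hm : (euclideanLebesgue d).map L = euclideanLebesgue d :=
    isAddHaarMeasure_map_linearIsometryEquiv (euclideanLebesgue d)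
      { toLinearEquiv := L.toLinearEquiv.restrictScalars ℝ, norm_map' := L.norm_map }
  have hL : Measurable L := L.continuous.measurable
  refine Measure.ext_of_lintegral _ fun f hf => ?_
  have h1 : Measurable fun x : EuclideanSpace ℂ (Fin d) =>
      f ((((√(d : ℝ) : ℝ) : ℂ))⁻¹ • x) := hf.comp (measurable_const_smul _)
  have h2 : Measurable fun x : EuclideanSpace ℂ (Fin d) =>
      f (L ((((√(d : ℝ) : ℝ) : ℂ))⁻¹ • x)) := (hf.comp hL).comp (measurable_const_smul _)
  have h3 : Measurable fun x => f (L x) := hf.comp hL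
  rw [lintegral_map hf hL, gaussianState_eq_map_withDensity,
    lintegral_map h3 (measurable_const_smul _),
    lintegral_map hf (measurable_const_smul _),
    lintegral_withDensity_eq_lintegral_mul _ (by fun_prop) h2,
    lintegral_withDensity_eq_lintegral_mul _ (by fun_prop) h1]
  conv_rhs => rw [← hm]
  rw [lintegral_map (by fun_prop) hL]
  simp

lemma gaussianState_map_unitaryAct {d : ℕ} (U : Matrix.unitaryGroup (Fin d) ℂ) :
    (gaussianState d).map (unitaryAct U) = gaussianState d := by
  let L : EuclideanSpace ℂ (Fin d) ≃ₗᵢ[ℂ] EuclideanSpace ℂ (Fin d) :=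
    { toFun := unitaryAct U
      invFun := unitaryAct U⁻¹
      left_inv := unitaryAct_inv_act U
      right_inv := fun x => by simpa using unitaryAct_inv_act U⁻¹ x
      map_add' := fun x y => by simp [unitaryAct, Matrix.mulVec_add]
      map_smul' := unitaryAct_smul U
      norm_map' := norm_unitaryAct U }
  exact gaussianState_map_linearIsometryEquiv L

lemma gaussianState_ae_ne_zero (d : ℕ) [NeZero d] : ∀ᵐ φ ∂gaussianState d, φ ≠ 0 := by
  have hs : MeasurableSet {φ : EuclideanSpace ℂ (Fin d) | φ ≠ 0} :=
    (measurableSet_singleton 0).compl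
  rw [gaussianState_eq_map_pi, ae_map_iff (measurable_toLp_div _).aemeasurable hs]
  have h0 : ∀ᵐ z ∂complexGaussian, z ≠ 0 :=
    (withDensity_absolutelyContinuous _ _).ae_le (Measure.ae_ne volume 0)
  have h := (Measure.quasiMeasurePreserving_eval (fun _ : Fin d => complexGaussian) 0).ae h0
  filter_upwards [h] with z hz hzero
  have := congrArg (fun x : EuclideanSpace ℂ (Fin d) => x 0) hzero
  have hd : (√(d : ℝ)) ≠ 0 := (Real.sqrt_pos.2 (by exact_mod_cast NeZero.pos d)).ne'
  simp [hd] at this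
  exact hz this

/-- The direction of a Gaussian vector. -/
noncomputable def direction {d : ℕ} (φ : EuclideanSpace ℂ (Fin d)) : EuclideanSpace ℂ (Fin d) :=
  ((‖φ‖⁻¹ : ℝ) : ℂ) • φ

lemma measurable_direction {d : ℕ} : Measurable (direction (d := d)) := by
  unfold direction
  fun_prop

lemma norm_direction {d : ℕ} {φ : EuclideanSpace ℂ (Fin d)} (hφ : φ ≠ 0) : ‖direction φ‖ = 1 := by
  have := norm_ne_zero_iff.2 hφ
  simp [direction, norm_smul, this]

lemma smul_direction {d : ℕ} (φ : EuclideanSpace ℂ (Fin d)) :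
    ((‖φ‖ : ℝ) : ℂ) • direction φ = φ := by
  by_cases hφ : φ = 0
  · simp [hφ]
  · have := norm_ne_zero_iff.2 hφ
    simp [direction, smul_smul, this]

lemma direction_unitaryAct {d : ℕ} (U : Matrix.unitaryGroup (Fin d) ℂ)
    (φ : EuclideanSpace ℂ (Fin d)) : direction (unitaryAct U φ) = unitaryAct U (direction φ) := by
  simp [direction, norm_unitaryAct, unitaryAct_smul]

/-- Rotating the Gaussian vector by $U$ changes neither its law nor its norm. Averaging over
Haar-random $U$ and exchanging the integrals turns the direction of each fixed nonzero vector into a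
Haar-random one. -/
lemma lintegral_gaussianState_direction_norm {d : ℕ} [NeZero d]
    {f : EuclideanSpace ℂ (Fin d) × ℝ → ENNReal} (hf : Measurable f) :
    ∫⁻ φ, f (direction φ, ‖φ‖) ∂gaussianState d =
      ∫⁻ φ, ∫⁻ ψ, f (ψ, ‖φ‖) ∂haarState d ∂gaussianState d := by
  have hmeas : Measurable fun φ : EuclideanSpace ℂ (Fin d) => f (direction φ, ‖φ‖) :=
    hf.comp (measurable_direction.prodMk measurable_norm)
  have h1 : ∀ U : Matrix.unitaryGroup (Fin d) ℂ,
      ∫⁻ φ, f (unitaryAct U (direction φ), ‖φ‖) ∂gaussianState d =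
        ∫⁻ φ, f (direction φ, ‖φ‖) ∂gaussianState d := by
    intro U
    conv_rhs => rw [← gaussianState_map_unitaryAct U]
    rw [lintegral_map hmeas
      (show Measurable (unitaryAct U) from measurable_unitaryAct.comp measurable_prodMk_left)]
    simp only [direction_unitaryAct, norm_unitaryAct]
  have h2 : ∫⁻ φ, f (direction φ, ‖φ‖) ∂gaussianState d =
      ∫⁻ U, ∫⁻ φ, f (unitaryAct U (direction φ), ‖φ‖) ∂gaussianState d ∂haarUnitary d := by
    rw [lintegral_congr h1, lintegral_const, measure_univ, mul_one]
  have h3 : Measurable (Function.uncurry fun (U : Matrix.unitaryGroup (Fin d) ℂ)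
      (φ : EuclideanSpace ℂ (Fin d)) => f (unitaryAct U (direction φ), ‖φ‖)) :=
    hf.comp ((measurable_unitaryAct.comp (measurable_fst.prodMk
      (measurable_direction.comp measurable_snd))).prodMk (measurable_norm.comp measurable_snd))
  rw [h2, lintegral_lintegral_swap h3.aemeasurable]
  refine lintegral_congr_ae ?_
  filter_upwards [gaussianState_ae_ne_zero d] with φ hφ
  rw [← map_unitaryAct_haarUnitary (norm_direction hφ),
    lintegral_map (show Measurable fun ψ => f (ψ, ‖φ‖) from hf.comp measurable_prodMk_right)
      (continuous_unitaryAct_left _).measurable]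

instance (d : ℕ) : IsProbabilityMeasure ((gaussianState d).map fun φ => ‖φ‖) :=
  Measure.isProbabilityMeasure_map measurable_norm.aemeasurable

/-- The direction of a Gaussian vector is Haar-distributed and independent of its norm. -/
lemma gaussianState_map_direction_norm (d : ℕ) [NeZero d] :
    (gaussianState d).map (fun φ => (direction φ, ‖φ‖)) =
      (haarState d).prod ((gaussianState d).map fun φ => ‖φ‖) := by
  refine Measure.ext_of_lintegral _ fun f hf => ?_
  rw [lintegral_map hf (measurable_direction.prodMk measurable_norm),
    lintegral_gaussianState_direction_norm hf, lintegral_prod_symm _ hf.aemeasurable,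
    lintegral_map hf.lintegral_prod_left' measurable_norm]

/-- Independence of norm and direction, in the form that carries means of functions homogeneous of
degree two from the Gaussian to the Haar ensemble. -/
lemma lintegral_gaussianState_eq {d : ℕ} [NeZero d] {f : EuclideanSpace ℂ (Fin d) → ENNReal}
    (hf : Measurable f) :
    ∫⁻ φ, ENNReal.ofReal (‖φ‖ ^ 2) * f (direction φ) ∂gaussianState d =
      (∫⁻ φ, ENNReal.ofReal (‖φ‖ ^ 2) ∂gaussianState d) * ∫⁻ ψ, f ψ ∂haarState d := by
  have hmeas : Measurable fun φ : EuclideanSpace ℂ (Fin d) => (direction φ, ‖φ‖) :=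
    measurable_direction.prodMk measurable_norm
  have h := lintegral_map (μ := gaussianState d)
    (f := fun p : EuclideanSpace ℂ (Fin d) × ℝ => f p.1 * ENNReal.ofReal (p.2 ^ 2))
    (by fun_prop) hmeas
  rw [gaussianState_map_direction_norm,
    lintegral_prod_mul (g := fun r : ℝ => ENNReal.ofReal (r ^ 2)) hf.aemeasurable (by fun_prop),
    lintegral_map (by fun_prop) measurable_norm] at h
  rw [mul_comm, h]
  simp_rw [mul_comm]

lemma lintegral_gaussianState_comp {d : ℕ} {f : (Fin d → ℝ) → ENNReal} (hf : Measurable f) :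
    ∫⁻ φ, f (fun j => ‖φ j‖ ^ 2) ∂gaussianState d =
      ∫⁻ t, f (fun j => t j / d) ∂(Measure.pi fun _ : Fin d => ProbabilityTheory.expMeasure 1) := by
  rw [gaussianState_eq_map_pi, lintegral_map (by fun_prop) (measurable_toLp_div _),
    ← pi_complexGaussian_map_norm_sq, lintegral_map (by fun_prop) (by fun_prop)]
  refine lintegral_congr fun z => ?_
  congr 1
  ext j
  simp [div_pow, Real.sq_sqrt]

lemma lintegral_gaussianState_norm_sq (d : ℕ) [NeZero d] :
    ∫⁻ φ, ENNReal.ofReal (‖φ‖ ^ 2) ∂gaussianState d = 1 := by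
  have h := lintegral_gaussianState_comp (d := d)
    (f := fun t => ∑ j, ENNReal.ofReal |t j|) (by fun_prop)
  have h1 : ∀ φ : EuclideanSpace ℂ (Fin d),
      ∑ j, ENNReal.ofReal |‖φ j‖ ^ 2| = ENNReal.ofReal (‖φ‖ ^ 2) := by
    intro φ
    rw [EuclideanSpace.norm_sq_eq, ENNReal.ofReal_sum_of_nonneg fun _ _ => by positivity]
    simp
  have h2 : ∀ j : Fin d, ∫⁻ t : Fin d → ℝ, ENNReal.ofReal |t j / d|
      ∂(Measure.pi fun _ : Fin d => ProbabilityTheory.expMeasure 1) = (d : ENNReal)⁻¹ := by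
    intro j
    have hmp := measurePreserving_eval (fun _ : Fin d => ProbabilityTheory.expMeasure 1) j
    have h3 := hmp.lintegral_comp (f := fun t : ℝ => ENNReal.ofReal |t / d|) (by fun_prop)
    have h4 : ∀ t : ℝ, ENNReal.ofReal |t / d| = ENNReal.ofReal |t| * (d : ENNReal)⁻¹ := by
      intro t
      rw [abs_div, Nat.abs_cast, ENNReal.ofReal_div_of_pos (by exact_mod_cast NeZero.pos d),
        ENNReal.ofReal_natCast, div_eq_mul_inv]
    refine h3.trans ?_
    simp only [h4]
    rw [lintegral_mul_const _ (by fun_prop), lintegral_expMeasure_ofReal, one_mul]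
  simp only [h1] at h
  rw [h, lintegral_finsetSum _ fun j _ => by fun_prop]
  simp only [h2, Finset.sum_const, Finset.card_univ, Fintype.card_fin, nsmul_eq_mul]
  exact ENNReal.mul_inv_cancel (by simp [NeZero.ne d]) (by simp)

/-- Forgetting the Euclidean structure by `ofLp` leaves the sup norm of the product, so `‖φ.ofLp‖ ^
2` is the largest squared modulus of a coordinate; this notation is used throughout. -/
lemma norm_ofLp_sq {d : ℕ} (φ : EuclideanSpace ℂ (Fin d)) :
    ‖φ.ofLp‖ ^ 2 = ‖fun j => ‖φ j‖ ^ 2‖ := by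
  refine le_antisymm ?_ ((pi_norm_le_iff_of_nonneg (by positivity)).2 fun j => ?_)
  · rw [← Real.sqrt_le_sqrt_iff (norm_nonneg _), Real.sqrt_sq (norm_nonneg _)]
    refine (pi_norm_le_iff_of_nonneg (Real.sqrt_nonneg _)).2 fun j => Real.le_sqrt_of_sq_le ?_
    exact (le_abs_self _).trans (norm_le_pi_norm (fun j => ‖φ j‖ ^ 2) j)
  · rw [norm_pow, norm_norm]
    exact pow_le_pow_left₀ (norm_nonneg _) (norm_le_pi_norm φ.ofLp j) 2

lemma lintegral_gaussianState_norm_ofLp_sq (d : ℕ) [NeZero d] :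
    ∫⁻ φ, ENNReal.ofReal (‖φ.ofLp‖ ^ 2) ∂gaussianState d =
      ENNReal.ofReal ((harmonic d : ℝ) / d) := by
  simp only [norm_ofLp_sq]
  rw [lintegral_gaussianState_comp (f := fun t => ENNReal.ofReal ‖t‖) (by fun_prop)]
  have hd : (0 : ℝ) < d := by exact_mod_cast NeZero.pos d
  have h1 : ∀ t : Fin d → ℝ, ENNReal.ofReal ‖fun j => t j / (d : ℝ)‖ =
      ENNReal.ofReal ‖t‖ * ENNReal.ofReal (d : ℝ)⁻¹ := by
    intro t
    have : (fun j => t j / (d : ℝ)) = (d : ℝ)⁻¹ • t := by ext j; simp [div_eq_inv_mul]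
    rw [this, norm_smul, mul_comm, ENNReal.ofReal_mul (norm_nonneg _)]
    simp
  simp only [h1]
  rw [lintegral_mul_const _ (by fun_prop), lintegral_pi_expMeasure_norm, div_eq_mul_inv,
    ← ENNReal.ofReal_mul' (by positivity)]

/-- The expected maximal squared modulus of a coordinate of a Haar-random state is `H_d / d`. -/
lemma lintegral_haarState_norm_ofLp_sq (d : ℕ) [NeZero d] :
    ∫⁻ ψ, ENNReal.ofReal (‖ψ.ofLp‖ ^ 2) ∂haarState d = ENNReal.ofReal ((harmonic d : ℝ) / d) := by
  have h := lintegral_gaussianState_eq (d := d)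
    (f := fun ψ => ENNReal.ofReal (‖ψ.ofLp‖ ^ 2)) (by fun_prop)
  rw [lintegral_gaussianState_norm_sq, one_mul] at h
  rw [← h, ← lintegral_gaussianState_norm_ofLp_sq]
  refine lintegral_congr fun φ => ?_
  rw [← ENNReal.ofReal_mul (by positivity), ← mul_pow]
  conv_rhs => rw [← smul_direction φ]
  rw [WithLp.ofLp_smul, norm_smul, Complex.norm_real, norm_norm]

lemma measurableSet_norm_ne {d : ℕ} (i j : Fin d) :
    MeasurableSet {φ : EuclideanSpace ℂ (Fin d) | ‖φ i‖ ≠ ‖φ j‖} :=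
  (measurableSet_eq_fun (f := fun φ : EuclideanSpace ℂ (Fin d) => ‖φ i‖) (g := fun φ => ‖φ j‖)
    (by fun_prop) (by fun_prop)).compl

lemma gaussianState_ae_norm_ne (d : ℕ) [NeZero d] {i j : Fin d} (hij : i ≠ j) :
    ∀ᵐ φ ∂gaussianState d, ‖φ i‖ ≠ ‖φ j‖ := by
  have h := pi_ae_ne _ expMeasure_singleton hij
  rw [← pi_complexGaussian_map_norm_sq] at h
  have h' := ae_of_ae_map
    (show Measurable fun (z : Fin d → ℂ) j => ‖z j‖ ^ 2 by fun_prop).aemeasurable h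
  rw [gaussianState_eq_map_pi, ae_map_iff (measurable_toLp_div _).aemeasurable
    (measurableSet_norm_ne i j)]
  filter_upwards [h'] with z hz h
  have hd : (√(d : ℝ)) ≠ 0 := (Real.sqrt_pos.2 (by exact_mod_cast NeZero.pos d)).ne'
  refine hz ?_
  simp only [norm_div] at h
  rw [div_left_inj' (by simpa using hd)] at h
  rw [h]

/-- Ties are null for Gaussian vectors, whose moduli are independent with atomless laws, and
normalization neither creates nor removes ties. -/
lemma haarState_ae_norm_ne (d : ℕ) [NeZero d] {i j : Fin d} (hij : i ≠ j) :
    ∀ᵐ ψ ∂haarState d, ‖ψ i‖ ≠ ‖ψ j‖ := by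
  have hmeas : Measurable fun φ : EuclideanSpace ℂ (Fin d) => (direction φ, ‖φ‖) :=
    measurable_direction.prodMk measurable_norm
  have hfst : (gaussianState d).map direction = haarState d := by
    have h := congrArg (fun m => m.map Prod.fst) (gaussianState_map_direction_norm d)
    simpa [Measure.map_map measurable_fst hmeas, Function.comp_def, Measure.map_fst_prod] using h
  rw [← hfst, ae_map_iff measurable_direction.aemeasurable (measurableSet_norm_ne i j)]
  filter_upwards [gaussianState_ae_ne_zero d, gaussianState_ae_norm_ne d hij] with φ h0 h
  have : ‖φ‖ ≠ 0 := norm_ne_zero_iff.2 h0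
  simpa [direction, this] using h

/-! ### Cheating strategies -/

open Classical in
/-- The indicator function of the event that `i` is the unique index of a coordinate of maximal
modulus. -/
noncomputable def strictMax {d : ℕ} (i : Fin d) (x : EuclideanSpace ℂ (Fin d)) : ℝ :=
  if ∀ j, j ≠ i → ‖x j‖ ^ 2 < ‖x i‖ ^ 2 then 1 else 0

lemma strictMax_nonneg {d : ℕ} (i : Fin d) (x : EuclideanSpace ℂ (Fin d)) : 0 ≤ strictMax i x := by
  unfold strictMax; split_ifs <;> norm_num

lemma strictMax_eq_zero_of_ne {d : ℕ} {i j : Fin d} {x : EuclideanSpace ℂ (Fin d)} (hij : j ≠ i)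
    (h : ∀ k, k ≠ i → ‖x k‖ ^ 2 < ‖x i‖ ^ 2) : strictMax j x = 0 :=
  if_neg fun hj => lt_asymm (h j hij) (hj i hij.symm)

lemma sum_strictMax_mul {d : ℕ} {i : Fin d} {x : EuclideanSpace ℂ (Fin d)}
    (h : ∀ k, k ≠ i → ‖x k‖ ^ 2 < ‖x i‖ ^ 2) (f : Fin d → ℝ) :
    ∑ j, strictMax j x * f j = f i := by
  rw [Finset.sum_eq_single i (fun j _ hj => by rw [strictMax_eq_zero_of_ne hj h, zero_mul])
    (by simp), strictMax, if_pos h, one_mul]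

lemma sum_strictMax_le_one {d : ℕ} (x : EuclideanSpace ℂ (Fin d)) : ∑ j, strictMax j x ≤ 1 := by
  by_cases h : ∃ i, ∀ k, k ≠ i → ‖x k‖ ^ 2 < ‖x i‖ ^ 2
  · obtain ⟨i, hi⟩ := h
    simpa using (sum_strictMax_mul hi fun _ => 1).le
  · push Not at h
    refine (Finset.sum_eq_zero fun i _ => if_neg ?_).le.trans zero_le_one
    push Not
    exact h i

lemma exists_strictMax {d : ℕ} [NeZero d] {x : EuclideanSpace ℂ (Fin d)}
    (hx : ∀ i j, i ≠ j → ‖x i‖ ≠ ‖x j‖) :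
    ∃ i, (∀ k, k ≠ i → ‖x k‖ ^ 2 < ‖x i‖ ^ 2) ∧ ‖x i‖ ^ 2 = ‖x.ofLp‖ ^ 2 := by
  obtain ⟨i, -, hi⟩ := Finset.exists_max_image (Finset.univ : Finset (Fin d)) (fun j => ‖x j‖)
    Finset.univ_nonempty
  refine ⟨i, fun k hk => ?_, ?_⟩
  · exact pow_lt_pow_left₀ (lt_of_le_of_ne (hi k (Finset.mem_univ k)) (hx k i hk))
      (norm_nonneg _) two_ne_zero
  · rw [le_antisymm (norm_le_pi_norm x.ofLp i)
      ((pi_norm_le_iff_of_nonneg (norm_nonneg _)).2 fun j => hi j (Finset.mem_univ j))]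

lemma measurable_strictMax {d : ℕ} (i : Fin d) : Measurable (strictMax i) := by
  refine Measurable.ite ?_ measurable_const measurable_const
  have : {x : EuclideanSpace ℂ (Fin d) | ∀ j, j ≠ i → ‖x j‖ ^ 2 < ‖x i‖ ^ 2} =
      ⋂ j, ⋂ (_ : j ≠ i), {x | ‖x j‖ ^ 2 < ‖x i‖ ^ 2} := by
    ext x; simp
  rw [this]
  refine MeasurableSet.iInter fun j => MeasurableSet.iInter fun _ => ?_
  exact measurableSet_lt (by fun_prop) (by fun_prop)

lemma closestEigenstate_eq {d : ℕ} (v : OrthonormalBasis (Fin d) ℂ (EuclideanSpace ℂ (Fin d)))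
    (a : Fin d) (ψ : EuclideanSpace ℂ (Fin d)) :
    closestEigenstate v a ψ = strictMax a (v.repr ψ) := by
  simp only [closestEigenstate, strictMax, OrthonormalBasis.repr_apply_apply]

lemma ae_pairwise_norm_ne {d : ℕ} {μ : Measure (EuclideanSpace ℂ (Fin d))}
    (hne : ∀ i j, i ≠ j → ∀ᵐ x ∂μ, ‖x i‖ ≠ ‖x j‖) :
    ∀ᵐ x ∂μ, ∀ i j, i ≠ j → ‖x i‖ ≠ ‖x j‖ := by
  simp only [ae_all_iff]
  exact hne

lemma norm_apply_sq_le_norm_ofLp_sq {d : ℕ} (x : EuclideanSpace ℂ (Fin d)) (i : Fin d) :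
    ‖x i‖ ^ 2 ≤ ‖x.ofLp‖ ^ 2 :=
  pow_le_pow_left₀ (norm_nonneg _) (norm_le_pi_norm x.ofLp i) 2

/-- Permutation of the coordinates of a vector. -/
noncomputable def permCoord {d : ℕ} (σ : Equiv.Perm (Fin d)) :
    EuclideanSpace ℂ (Fin d) ≃ₗᵢ[ℂ] EuclideanSpace ℂ (Fin d) :=
  LinearIsometryEquiv.piLpCongrLeft 2 ℂ ℂ σ

lemma permCoord_apply {d : ℕ} (σ : Equiv.Perm (Fin d)) (x : EuclideanSpace ℂ (Fin d))
    (i : Fin d) : permCoord σ x (σ i) = x i := by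
  simp [permCoord]

lemma strictMax_permCoord {d : ℕ} (σ : Equiv.Perm (Fin d)) (i : Fin d)
    (x : EuclideanSpace ℂ (Fin d)) : strictMax (σ i) (permCoord σ x) = strictMax i x := by
  have h : (∀ j, j ≠ σ i → ‖permCoord σ x j‖ ^ 2 < ‖permCoord σ x (σ i)‖ ^ 2) ↔
      ∀ j, j ≠ i → ‖x j‖ ^ 2 < ‖x i‖ ^ 2 := by
    rw [← σ.forall_congr_right]
    simp [permCoord_apply]
  simp only [strictMax, h]

lemma integral_comp_linearIsometryEquiv {d : ℕ} {μ : Measure (EuclideanSpace ℂ (Fin d))}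
    (L : EuclideanSpace ℂ (Fin d) ≃ₗᵢ[ℂ] EuclideanSpace ℂ (Fin d)) (hL : μ.map L = μ)
    {F : Type*} [NormedAddCommGroup F] [NormedSpace ℝ F] (f : EuclideanSpace ℂ (Fin d) → F) :
    ∫ x, f (L x) ∂μ = ∫ x, f x ∂μ := by
  conv_rhs => rw [← hL]
  exact (L.toHomeomorph.measurableEmbedding.integral_map f).symm

lemma integrable_norm_ofLp_sq {d : ℕ} {μ : Measure (EuclideanSpace ℂ (Fin d))} {c : ℝ}
    (hmax : ∫⁻ x, ENNReal.ofReal (‖x.ofLp‖ ^ 2) ∂μ = ENNReal.ofReal c) :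
    Integrable (fun x : EuclideanSpace ℂ (Fin d) => ‖x.ofLp‖ ^ 2) μ := by
  refine ⟨by fun_prop, ?_⟩
  rw [hasFiniteIntegral_iff_ofReal (Eventually.of_forall fun x => by positivity), hmax]
  exact ENNReal.ofReal_lt_top

lemma integral_norm_ofLp_sq {d : ℕ} {μ : Measure (EuclideanSpace ℂ (Fin d))} {c : ℝ} (hc : 0 ≤ c)
    (hmax : ∫⁻ x, ENNReal.ofReal (‖x.ofLp‖ ^ 2) ∂μ = ENNReal.ofReal c) :
    ∫ x, ‖x.ofLp‖ ^ 2 ∂μ = c := by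
  rw [integral_eq_lintegral_of_nonneg_ae (Eventually.of_forall fun x => by positivity)
    (by fun_prop), hmax, ENNReal.toReal_ofReal hc]

/-- For a unitarily invariant ensemble, the overlap of the strategy of the strictly largest
coordinate is the same for all outcomes. -/
lemma integral_strictMax {d : ℕ} [NeZero d] {μ : Measure (EuclideanSpace ℂ (Fin d))} {c : ℝ}
    (hμ : ∀ L : EuclideanSpace ℂ (Fin d) ≃ₗᵢ[ℂ] EuclideanSpace ℂ (Fin d), μ.map L = μ)
    (hne : ∀ i j, i ≠ j → ∀ᵐ x ∂μ, ‖x i‖ ≠ ‖x j‖) (hc : 0 ≤ c)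
    (hmax : ∫⁻ x, ENNReal.ofReal (‖x.ofLp‖ ^ 2) ∂μ = ENNReal.ofReal c) (a : Fin d) :
    ∫ x, strictMax a x * ‖x a‖ ^ 2 ∂μ = c / d := by
  have hint : ∀ i, Integrable (fun x => strictMax i x * ‖x i‖ ^ 2) μ := by
    intro i
    refine (integrable_norm_ofLp_sq hmax).mono'
      ((measurable_strictMax i).mul (by fun_prop)).aestronglyMeasurable
      (Eventually.of_forall fun x => ?_)
    rw [Real.norm_of_nonneg (mul_nonneg (strictMax_nonneg _ _) (by positivity))]
    have h1 : strictMax i x ≤ 1 := by unfold strictMax; split_ifs <;> norm_num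
    exact (mul_le_of_le_one_left (by positivity) h1).trans (norm_apply_sq_le_norm_ofLp_sq x i)
  -- Almost surely exactly one indicator equals one, and it selects the largest squared modulus.
  have hsum : ∑ i, ∫ x, strictMax i x * ‖x i‖ ^ 2 ∂μ = c := by
    rw [← integral_finsetSum _ fun i _ => hint i, ← integral_norm_ofLp_sq hc hmax]
    refine integral_congr_ae ?_
    filter_upwards [ae_pairwise_norm_ne hne] with x hx
    obtain ⟨i, hi, himax⟩ := exists_strictMax hx
    rw [sum_strictMax_mul hi fun i => ‖x i‖ ^ 2, himax]
  have hsymm : ∀ i, ∫ x, strictMax i x * ‖x i‖ ^ 2 ∂μ = ∫ x, strictMax a x * ‖x a‖ ^ 2 ∂μ := by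
    intro i
    rw [← integral_comp_linearIsometryEquiv (permCoord (Equiv.swap a i)) (hμ _)]
    refine integral_congr_ae (Eventually.of_forall fun x => ?_)
    have h1 := strictMax_permCoord (Equiv.swap a i) a x
    have h2 := permCoord_apply (Equiv.swap a i) x a
    rw [Equiv.swap_apply_left] at h1 h2
    simp only [h1, h2]
  simp only [hsymm, Finset.sum_const, Finset.card_univ, Fintype.card_fin, nsmul_eq_mul] at hsum
  have hd : (d : ℝ) ≠ 0 := by exact_mod_cast NeZero.ne d
  rw [← hsum]
  field_simp

lemma overlap_closestEigenstate {d : ℕ} [NeZero d] {μ : Measure (EuclideanSpace ℂ (Fin d))} {c : ℝ}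
    (hμ : ∀ L : EuclideanSpace ℂ (Fin d) ≃ₗᵢ[ℂ] EuclideanSpace ℂ (Fin d), μ.map L = μ)
    (hne : ∀ i j, i ≠ j → ∀ᵐ x ∂μ, ‖x i‖ ≠ ‖x j‖) (hc : 0 ≤ c)
    (hmax : ∫⁻ x, ENNReal.ofReal (‖x.ofLp‖ ^ 2) ∂μ = ENNReal.ofReal c)
    (v : OrthonormalBasis (Fin d) ℂ (EuclideanSpace ℂ (Fin d))) (a : Fin d) :
    overlap μ v (closestEigenstate v) a = c / d := by
  rw [← integral_strictMax hμ hne hc hmax a, ← integral_comp_linearIsometryEquiv v.repr (hμ _)]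
  simp only [overlap, closestEigenstate_eq, OrthonormalBasis.repr_apply_apply]

lemma harmonic_cast_nonneg (d : ℕ) : (0 : ℝ) ≤ (harmonic d : ℝ) := by
  rw [harmonic]
  push_cast
  positivity

lemma haarState_overlap_closestEigenstate {d : ℕ} [NeZero d]
    (v : OrthonormalBasis (Fin d) ℂ (EuclideanSpace ℂ (Fin d))) (a : Fin d) :
    overlap (haarState d) v (closestEigenstate v) a = (harmonic d : ℝ) / (d : ℝ) ^ 2 := by
  rw [overlap_closestEigenstate haarState_map_linearIsometryEquiv
    (fun i j => haarState_ae_norm_ne d) (div_nonneg (harmonic_cast_nonneg d) d.cast_nonneg)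
    (lintegral_haarState_norm_ofLp_sq d), div_div, sq]

lemma gaussianState_overlap_closestEigenstate {d : ℕ} [NeZero d]
    (v : OrthonormalBasis (Fin d) ℂ (EuclideanSpace ℂ (Fin d))) (a : Fin d) :
    overlap (gaussianState d) v (closestEigenstate v) a = (harmonic d : ℝ) / (d : ℝ) ^ 2 := by
  rw [overlap_closestEigenstate gaussianState_map_linearIsometryEquiv
    (fun i j => gaussianState_ae_norm_ne d) (div_nonneg (harmonic_cast_nonneg d) d.cast_nonneg)
    (lintegral_gaussianState_norm_ofLp_sq d), div_div, sq]

lemma isCheatingStrategy_closestEigenstate {d : ℕ} [NeZero d]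
    (v : OrthonormalBasis (Fin d) ℂ (EuclideanSpace ℂ (Fin d))) :
    IsCheatingStrategy (haarState d) (closestEigenstate v) := by
  have heq : ∀ a, closestEigenstate v a = fun ψ => strictMax a (v.repr ψ) := fun a =>
    funext (closestEigenstate_eq v a)
  refine ⟨fun a => ?_, ?_⟩
  · rw [heq]
    exact (measurable_strictMax a).comp v.repr.continuous.measurable
  · have h := ae_pairwise_norm_ne fun i j => haarState_ae_norm_ne d (i := i) (j := j)
    rw [← haarState_map_linearIsometryEquiv v.repr] at h
    filter_upwards [ae_of_ae_map v.repr.continuous.measurable.aemeasurable h] with ψ hψ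
    refine ⟨fun a => by rw [heq]; exact strictMax_nonneg _ _, ?_⟩
    obtain ⟨i, hi, -⟩ := exists_strictMax hψ
    simpa [heq] using sum_strictMax_mul hi fun _ => 1

/-- Pointwise, a convex combination of the $|\langle v_a|\psi\rangle|^2$ is at most their maximum,
whose mean is $H_d/d$ in every basis by unitary invariance. -/
lemma haarState_average_overlap_le {d : ℕ} [NeZero d]
    (v : OrthonormalBasis (Fin d) ℂ (EuclideanSpace ℂ (Fin d)))
    {p : Fin d → EuclideanSpace ℂ (Fin d) → ℝ} (hp : IsCheatingStrategy (haarState d) p) :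
    (∑ a, overlap (haarState d) v p a) / (d : ℝ) ≤ (harmonic d : ℝ) / (d : ℝ) ^ 2 := by
  obtain ⟨hmeas, hprob⟩ := hp
  have hmax := lintegral_haarState_norm_ofLp_sq d
  have hintmax : Integrable (fun ψ => ‖(v.repr ψ).ofLp‖ ^ 2) (haarState d) := by
    have h := integrable_norm_ofLp_sq hmax
    rw [← haarState_map_linearIsometryEquiv v.repr] at h
    exact h.comp_measurable v.repr.continuous.measurable
  have hle : ∀ ψ a, ‖inner ℂ (v a) ψ‖ ^ 2 ≤ ‖(v.repr ψ).ofLp‖ ^ 2 := fun ψ a => by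
    rw [← OrthonormalBasis.repr_apply_apply]
    exact norm_apply_sq_le_norm_ofLp_sq _ a
  have hint : ∀ a, Integrable (fun ψ => p a ψ * ‖inner ℂ (v a) ψ‖ ^ 2) (haarState d) := by
    intro a
    refine hintmax.mono' ((hmeas a).mul (by fun_prop)).aestronglyMeasurable ?_
    filter_upwards [hprob] with ψ ⟨h0, h1⟩
    rw [Real.norm_of_nonneg (mul_nonneg (h0 a) (by positivity))]
    have hp1 : p a ψ ≤ 1 := h1 ▸ Finset.single_le_sum (fun b _ => h0 b) (Finset.mem_univ a)
    exact (mul_le_of_le_one_left (by positivity) hp1).trans (hle ψ a)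
  have hsum : ∑ a, overlap (haarState d) v p a ≤ (harmonic d : ℝ) / d := by
    rw [← integral_norm_ofLp_sq (div_nonneg (harmonic_cast_nonneg d) d.cast_nonneg) hmax,
      ← integral_comp_linearIsometryEquiv v.repr (haarState_map_linearIsometryEquiv _)]
    unfold overlap
    rw [← integral_finsetSum _ fun a _ => hint a]
    refine integral_mono_ae (integrable_finsetSum _ fun a _ => hint a) hintmax ?_
    filter_upwards [hprob] with ψ ⟨h0, h1⟩
    calc ∑ a, p a ψ * ‖inner ℂ (v a) ψ‖ ^ 2
        ≤ ∑ a, p a ψ * ‖(v.repr ψ).ofLp‖ ^ 2 :=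
          Finset.sum_le_sum fun a _ => mul_le_mul_of_nonneg_left (hle ψ a) (h0 a)
      _ = ‖(v.repr ψ).ofLp‖ ^ 2 := by rw [← Finset.sum_mul, h1, one_mul]
  rw [sq, ← div_div]
  exact div_le_div_of_nonneg_right hsum d.cast_nonneg

lemma isGreatest_overlap {d : ℕ} [NeZero d]
    (v : OrthonormalBasis (Fin d) ℂ (EuclideanSpace ℂ (Fin d))) :
    IsGreatest {x : ℝ | ∃ p, IsCheatingStrategy (haarState d) p ∧
      ∀ a, overlap (haarState d) v p a = x} ((harmonic d : ℝ) / (d : ℝ) ^ 2) := by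
  refine ⟨⟨closestEigenstate v, isCheatingStrategy_closestEigenstate v,
    haarState_overlap_closestEigenstate v⟩, ?_⟩
  rintro x ⟨p, hp, hx⟩
  have h := haarState_average_overlap_le v hp
  have hd : (d : ℝ) ≠ 0 := by exact_mod_cast NeZero.ne d
  simpa [hx, hd] using h

/-! ### Covariant strategies -/

lemma haarState_integrable {d : ℕ} [NeZero d] {F : Type*} [NormedAddCommGroup F]
    {f : EuclideanSpace ℂ (Fin d) → F} (hf : AEStronglyMeasurable f (haarState d)) (C : ℝ)
    (hC : ∀ x, ‖x‖ = 1 → ‖f x‖ ≤ C) : Integrable f (haarState d) :=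
  Integrable.of_bound hf C ((haarState_ae_norm_eq_one d).mono hC)

lemma haarState_integrable_of_continuous {d : ℕ} [NeZero d] {f : EuclideanSpace ℂ (Fin d) → ℝ}
    (hf : Continuous f) : Integrable f (haarState d) := by
  obtain ⟨C, hC⟩ := (isCompact_sphere (0 : EuclideanSpace ℂ (Fin d)) 1).exists_bound_of_continuousOn
    hf.continuousOn
  exact haarState_integrable hf.measurable.aestronglyMeasurable C fun x hx => hC x (by simpa using hx)

lemma norm_apply_le_one {d : ℕ} {x : EuclideanSpace ℂ (Fin d)} (hx : ‖x‖ = 1) (i : Fin d) :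
    ‖x i‖ ≤ 1 :=
  (PiLp.norm_apply_le x i).trans hx.le

/-- A strategy for the measurement in the computational basis that depends only on the moduli of
the coordinates, equivariantly under permutations. -/
structure IsCovariantStrategy {d : ℕ} (p : Fin d → EuclideanSpace ℂ (Fin d) → ℝ) : Prop where
  measurable : ∀ i, Measurable (p i)
  -- This and the normalization are required on the whole sphere, since a `HiddenStateModel` needs
  -- genuine response probabilities at every hidden state, not merely almost every one.
  nonneg : ∀ i x, ‖x‖ = 1 → 0 ≤ p i x
  sum_eq_one : ∀ x, ‖x‖ = 1 → ∑ i, p i x = 1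
  phase : ∀ i x y, (∀ j, ‖x j‖ = ‖y j‖) → p i x = p i y
  perm : ∀ (σ : Equiv.Perm (Fin d)) i x, p (σ i) (permCoord σ x) = p i x

namespace IsCovariantStrategy

variable {d : ℕ} {p : Fin d → EuclideanSpace ℂ (Fin d) → ℝ}

lemma le_one (hp : IsCovariantStrategy p) (i : Fin d) {x : EuclideanSpace ℂ (Fin d)}
    (hx : ‖x‖ = 1) : p i x ≤ 1 :=
  hp.sum_eq_one x hx ▸ Finset.single_le_sum (fun j _ => hp.nonneg j x hx) (Finset.mem_univ i)

lemma norm_le_one (hp : IsCovariantStrategy p) (i : Fin d) {x : EuclideanSpace ℂ (Fin d)}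
    (hx : ‖x‖ = 1) : ‖p i x‖ ≤ 1 := by
  rw [Real.norm_of_nonneg (hp.nonneg i x hx)]
  exact hp.le_one i hx

lemma integrable [NeZero d] (hp : IsCovariantStrategy p) (i : Fin d) :
    Integrable (p i) (haarState d) :=
  haarState_integrable (hp.measurable i).aestronglyMeasurable 1 fun _ => hp.norm_le_one i

lemma integrable_mul [NeZero d] (hp : IsCovariantStrategy p) (i j k : Fin d) :
    Integrable (fun x => (p i x : ℂ) * (x j * star (x k))) (haarState d) := by
  have := hp.measurable i
  refine haarState_integrable (Measurable.aestronglyMeasurable (by fun_prop)) 1 fun x hx => ?_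
  rw [norm_mul, norm_mul, norm_star, Complex.norm_real]
  have h1 := norm_apply_le_one hx j
  have h2 := norm_apply_le_one hx k
  exact mul_le_one₀ (hp.norm_le_one i hx) (by positivity) (mul_le_one₀ h1 (norm_nonneg _) h2)

lemma integrable_mul_norm_sq [NeZero d] (hp : IsCovariantStrategy p) (i j : Fin d) :
    Integrable (fun x => p i x * ‖x j‖ ^ 2) (haarState d) := by
  have := hp.measurable i
  refine haarState_integrable (Measurable.aestronglyMeasurable (by fun_prop)) 1 fun x hx => ?_
  rw [norm_mul, norm_pow, norm_norm]
  exact mul_le_one₀ (hp.norm_le_one i hx) (by positivity)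
    (pow_le_one₀ (norm_nonneg _) (norm_apply_le_one hx j))

lemma integral_perm [NeZero d] (hp : IsCovariantStrategy p) (σ : Equiv.Perm (Fin d)) (i j : Fin d) :
    ∫ x, p (σ i) x * ‖x (σ j)‖ ^ 2 ∂haarState d = ∫ x, p i x * ‖x j‖ ^ 2 ∂haarState d := by
  rw [← integral_comp_linearIsometryEquiv (permCoord σ) (haarState_map_linearIsometryEquiv _)]
  simp only [hp.perm, permCoord_apply]

lemma integral_eq [NeZero d] (hp : IsCovariantStrategy p) (i : Fin d) :
    ∫ x, p i x ∂haarState d = 1 / d := by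
  have hsymm : ∀ j, ∫ x, p j x ∂haarState d = ∫ x, p i x ∂haarState d := by
    intro j
    rw [← integral_comp_linearIsometryEquiv (permCoord (Equiv.swap i j))
      (haarState_map_linearIsometryEquiv _)]
    refine integral_congr_ae (Eventually.of_forall fun x => ?_)
    have := hp.perm (Equiv.swap i j) i x
    rwa [Equiv.swap_apply_left] at this
  have hsum : ∑ j, ∫ x, p j x ∂haarState d = 1 := by
    rw [← integral_finsetSum _ fun j _ => hp.integrable j]
    have : ∀ᵐ x ∂haarState d, ∑ j, p j x = 1 :=
      (haarState_ae_norm_eq_one d).mono hp.sum_eq_one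
    rw [integral_congr_ae this]
    simp
  simp only [hsymm, Finset.sum_const, Finset.card_univ, Fintype.card_fin, nsmul_eq_mul] at hsum
  have hd : (d : ℝ) ≠ 0 := by exact_mod_cast NeZero.ne d
  field_simp
  linarith

/-- The overlaps with the other outcomes. -/
lemma integral_mul_norm_sq_of_ne [NeZero d] (hp : IsCovariantStrategy p) (hd : 2 ≤ d) {i j : Fin d}
    (hij : j ≠ i) :
    ∫ x, p i x * ‖x j‖ ^ 2 ∂haarState d =
      (1 / d - ∫ x, p i x * ‖x i‖ ^ 2 ∂haarState d) / (d - 1) := by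
  -- The transposition of $j$ and $k$ fixes $i$, so the overlaps with all other outcomes agree;
  -- normalization of the state gives their sum.
  have hsymm : ∀ k, k ≠ i → ∫ x, p i x * ‖x k‖ ^ 2 ∂haarState d =
      ∫ x, p i x * ‖x j‖ ^ 2 ∂haarState d := by
    intro k hk
    have h := hp.integral_perm (Equiv.swap j k) i j
    rwa [Equiv.swap_apply_left, Equiv.swap_apply_of_ne_of_ne hij.symm hk.symm] at h
  have hsum : ∑ k, ∫ x, p i x * ‖x k‖ ^ 2 ∂haarState d = 1 / d := by
    rw [← integral_finsetSum _ fun k _ => hp.integrable_mul_norm_sq i k, ← hp.integral_eq i]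
    refine integral_congr_ae ((haarState_ae_norm_eq_one d).mono fun x hx => ?_)
    beta_reduce
    rw [← Finset.mul_sum, ← EuclideanSpace.norm_sq_eq, hx, one_pow, mul_one]
  rw [← Finset.add_sum_erase _ _ (Finset.mem_univ i),
    Finset.sum_congr rfl fun k hk => hsymm k (Finset.ne_of_mem_erase hk)] at hsum
  simp only [Finset.sum_const, Finset.card_erase_of_mem (Finset.mem_univ i), Finset.card_univ,
    Fintype.card_fin, nsmul_eq_mul] at hsum
  rw [Nat.cast_sub (by omega), Nat.cast_one] at hsum
  have hd1 : (d : ℝ) - 1 ≠ 0 := by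
    have : (2 : ℝ) ≤ d := by exact_mod_cast hd
    linarith
  rw [eq_div_iff hd1]
  linarith

/-- Flipping the sign of the single coordinate $j$ preserves the ensemble and the strategy but
negates the integrand. -/
lemma integral_mul_eq_zero [NeZero d] (hp : IsCovariantStrategy p) (i : Fin d)
    {j k : Fin d} (hjk : j ≠ k) :
    ∫ x, (p i x : ℂ) * (x j * star (x k)) ∂haarState d = 0 := by
  let L : EuclideanSpace ℂ (Fin d) ≃ₗᵢ[ℂ] EuclideanSpace ℂ (Fin d) :=
    LinearIsometryEquiv.piLpCongrRight 2 fun l =>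
      if l = j then LinearIsometryEquiv.neg ℂ else LinearIsometryEquiv.refl ℂ ℂ
  have hL : ∀ x l, L x l = if l = j then -x l else x l := by
    intro x l
    by_cases h : l = j <;> simp [L, h]
  have h := integral_comp_linearIsometryEquiv L (haarState_map_linearIsometryEquiv L)
    fun x => (p i x : ℂ) * (x j * star (x k))
  have hp' : ∀ x, p i (L x) = p i x := fun x => hp.phase i _ _ fun l => by
    rw [hL]; split_ifs <;> simp
  simp only [hp', hL, if_true, if_neg hjk.symm, neg_mul, mul_neg, integral_neg] at h
  exact self_eq_neg.1 h.symm

/-- The ensemble operator of a covariant strategy is diagonal. -/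
lemma integral_mul_inner [NeZero d] (hp : IsCovariantStrategy p) (i : Fin d)
    (b : EuclideanSpace ℂ (Fin d)) :
    ∫ x, p i x * ‖inner ℂ b x‖ ^ 2 ∂haarState d =
      ∑ j, ‖b j‖ ^ 2 * ∫ x, p i x * ‖x j‖ ^ 2 ∂haarState d := by
  have hexp : ∀ x : EuclideanSpace ℂ (Fin d), ((p i x * ‖inner ℂ b x‖ ^ 2 : ℝ) : ℂ) =
      ∑ j, ∑ k, (star (b j) * b k) * ((p i x : ℂ) * (x j * star (x k))) := by
    intro x
    rw [Complex.ofReal_mul, Complex.ofReal_pow, ← Complex.mul_conj', PiLp.inner_apply, map_sum,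
      Finset.sum_mul_sum, Finset.mul_sum]
    refine Finset.sum_congr rfl fun j _ => ?_
    rw [Finset.mul_sum]
    refine Finset.sum_congr rfl fun k _ => ?_
    simp
    ring
  apply Complex.ofReal_injective
  rw [← integral_complex_ofReal]
  simp only [hexp]
  rw [integral_finsetSum _ fun j _ => integrable_finsetSum _ fun k _ =>
    (hp.integrable_mul i j k).const_mul _, Complex.ofReal_sum]
  refine Finset.sum_congr rfl fun j _ => ?_
  rw [integral_finsetSum _ fun k _ => (hp.integrable_mul i j k).const_mul _,
    Finset.sum_eq_single j]
  · rw [integral_const_mul, Complex.ofReal_mul, ← integral_complex_ofReal]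
    congr 1
    · rw [mul_comm]; simpa using Complex.mul_conj' (b j)
    · refine integral_congr_ae (Eventually.of_forall fun x => ?_)
      have := Complex.mul_conj' (x j)
      simp only [Complex.star_def, this]
      push_cast
      rfl
  · intro k _ hk
    rw [integral_const_mul, hp.integral_mul_eq_zero i hk.symm, mul_zero]
  · simp

/-- The ensemble operator of a covariant strategy is a combination of the projector onto the
measured state and the identity. -/
lemma integral_mul_inner_eq [NeZero d] (hp : IsCovariantStrategy p) (hd : 2 ≤ d) (i : Fin d)
    (b : EuclideanSpace ℂ (Fin d)) {c : ℝ}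
    (hc : ∫ x, p i x * ‖x i‖ ^ 2 ∂haarState d = c) :
    ∫ x, p i x * ‖inner ℂ b x‖ ^ 2 ∂haarState d =
      ‖b i‖ ^ 2 * c + (‖b‖ ^ 2 - ‖b i‖ ^ 2) * ((1 / d - c) / (d - 1)) := by
  rw [hp.integral_mul_inner, ← Finset.add_sum_erase _ _ (Finset.mem_univ i), hc,
    EuclideanSpace.norm_sq_eq b, ← Finset.add_sum_erase _ _ (Finset.mem_univ i),
    Finset.sum_congr rfl fun k hk => by
      rw [hp.integral_mul_norm_sq_of_ne hd (Finset.ne_of_mem_erase hk), hc], ← Finset.sum_mul]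
  ring

lemma convexCombination {q : Fin d → EuclideanSpace ℂ (Fin d) → ℝ} (hp : IsCovariantStrategy p)
    (hq : IsCovariantStrategy q) {s t : ℝ} (hs : 0 ≤ s) (ht : 0 ≤ t) (hst : s + t = 1) :
    IsCovariantStrategy fun i x => s * p i x + t * q i x where
  measurable i := by
    have := hp.measurable i
    have := hq.measurable i
    fun_prop
  nonneg i x hx := add_nonneg (mul_nonneg hs (hp.nonneg i x hx)) (mul_nonneg ht (hq.nonneg i x hx))
  sum_eq_one x hx := by
    rw [Finset.sum_add_distrib, ← Finset.mul_sum, ← Finset.mul_sum, hp.sum_eq_one x hx,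
      hq.sum_eq_one x hx]
    linarith
  phase i x y h := by rw [hp.phase i x y h, hq.phase i x y h]
  perm σ i x := by rw [hp.perm, hq.perm]

end IsCovariantStrategy

/-- The strategy of the largest coordinate, with a uniformly random answer in case of a tie. -/
noncomputable def tieBreakMax {d : ℕ} (i : Fin d) (x : EuclideanSpace ℂ (Fin d)) : ℝ :=
  strictMax i x + (1 - ∑ k, strictMax k x) / d

/-- Sharing the missing mass equally restores normalization at every vector, ties included, without
breaking the symmetry. -/
lemma isCovariantStrategy_tieBreakMax {d : ℕ} [NeZero d] :
    IsCovariantStrategy (tieBreakMax (d := d)) where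
  measurable i := by
    have := measurable_strictMax (d := d)
    unfold tieBreakMax
    fun_prop
  nonneg i x _ := add_nonneg (strictMax_nonneg i x)
    (div_nonneg (sub_nonneg.2 (sum_strictMax_le_one x)) d.cast_nonneg)
  sum_eq_one x _ := by
    have hd : (d : ℝ) ≠ 0 := by exact_mod_cast NeZero.ne d
    simp only [tieBreakMax, Finset.sum_add_distrib, Finset.sum_const, Finset.card_univ,
      Fintype.card_fin, nsmul_eq_mul]
    field_simp
    ring
  phase i x y h := by simp only [tieBreakMax, strictMax, h]
  perm σ i x := by
    rw [tieBreakMax, strictMax_permCoord, ← Equiv.sum_comp σ fun k => strictMax k (permCoord σ x)]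
    simp only [strictMax_permCoord, tieBreakMax]

lemma integral_tieBreakMax {d : ℕ} [NeZero d] (i : Fin d) :
    ∫ x, tieBreakMax i x * ‖x i‖ ^ 2 ∂haarState d = (harmonic d : ℝ) / (d : ℝ) ^ 2 := by
  have h := integral_strictMax haarState_map_linearIsometryEquiv
    (fun i j => haarState_ae_norm_ne d) (div_nonneg (harmonic_cast_nonneg d) d.cast_nonneg)
    (lintegral_haarState_norm_ofLp_sq d) i
  rw [sq, ← div_div, ← h]
  refine integral_congr_ae ?_
  filter_upwards [ae_pairwise_norm_ne fun i j => haarState_ae_norm_ne d (i := i) (j := j)]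
    with x hx
  obtain ⟨k, hk, -⟩ := exists_strictMax hx
  have h1 := sum_strictMax_mul hk fun _ => 1
  simp only [mul_one] at h1
  simp [tieBreakMax, h1]

/-! ### The fourth moment of the Haar ensemble and the complementary strategy -/

/-- Read as a strategy, $|x_i|^2$ has fourth moments as its overlaps, so the general relation
between overlaps applies to them. -/
lemma isCovariantStrategy_norm_sq {d : ℕ} :
    IsCovariantStrategy fun (i : Fin d) (x : EuclideanSpace ℂ (Fin d)) => ‖x i‖ ^ 2 where
  measurable i := by fun_prop
  nonneg i x _ := by positivity
  sum_eq_one x hx := by rw [← EuclideanSpace.norm_sq_eq, hx, one_pow]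
  phase i x y h := by rw [h]
  perm σ i x := by rw [permCoord_apply]

lemma integral_inner_pow_four {d : ℕ} [NeZero d] (i : Fin d) {b : EuclideanSpace ℂ (Fin d)}
    (hb : ‖b‖ = 1) :
    ∫ x, ‖inner ℂ b x‖ ^ 4 ∂haarState d = ∫ x, ‖x i‖ ^ 4 ∂haarState d := by
  obtain ⟨v, hv⟩ := exists_orthonormalBasis_apply_eq i hb
  conv_rhs =>
    rw [← integral_comp_linearIsometryEquiv v.repr (haarState_map_linearIsometryEquiv _)]
  simp only [OrthonormalBasis.repr_apply_apply, hv]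

lemma integral_inner_pow_four' {d : ℕ} [NeZero d] (i : Fin d) (b : EuclideanSpace ℂ (Fin d)) :
    ∫ x, ‖inner ℂ b x‖ ^ 4 ∂haarState d = ‖b‖ ^ 4 * ∫ x, ‖x i‖ ^ 4 ∂haarState d := by
  by_cases hb : b = 0
  · simp [hb]
  · rw [← integral_inner_pow_four i (norm_direction hb), ← integral_const_mul]
    refine integral_congr_ae (Eventually.of_forall fun x => ?_)
    beta_reduce
    conv_lhs => rw [← smul_direction b]
    rw [inner_smul_left, norm_mul, mul_pow]
    simp

/-- Summing $|a+cb|^4$ over the fourth roots of unity $c$ cancels every term that depends on the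
relative phase. -/
lemma sum_norm_add_pow_four (a b : ℂ) :
    ‖a + b‖ ^ 4 + ‖a - b‖ ^ 4 + ‖a + Complex.I * b‖ ^ 4 + ‖a - Complex.I * b‖ ^ 4 =
      4 * (‖a‖ ^ 4 + ‖b‖ ^ 4 + 4 * (‖a‖ ^ 2 * ‖b‖ ^ 2)) := by
  have h : ∀ z : ℂ, ‖z‖ ^ 4 = (z.re ^ 2 + z.im ^ 2) ^ 2 := fun z => by
    rw [show 4 = 2 * 2 from rfl, pow_mul, Complex.sq_norm, Complex.normSq_apply]; ring
  simp only [h, Complex.sq_norm, Complex.normSq_apply, Complex.add_re, Complex.add_im,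
    Complex.sub_re, Complex.sub_im, Complex.mul_re, Complex.mul_im, Complex.I_re, Complex.I_im]
  ring

/-- Two linear relations determine $m=\mathbb E|x_i|^4$ and $q=\mathbb E|x_i|^2|x_j|^2$.
Normalization gives $q=(1/d-m)/(d-1)$. Unitary invariance gives $\mathbb E|x_i+cx_j|^4=4m$ for
$|c|=1$, and summing over the fourth roots of unity yields $m=2q$. -/
lemma integral_norm_pow_four {d : ℕ} [NeZero d] (hd : 2 ≤ d) (i : Fin d) :
    ∫ x, ‖x i‖ ^ 4 ∂haarState d = 2 / ((d : ℝ) * (d + 1)) := by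
  have : Nontrivial (Fin d) := Fin.nontrivial_iff_two_le.2 hd
  obtain ⟨j, hj⟩ := exists_ne i
  set m := ∫ x : EuclideanSpace ℂ (Fin d), ‖x i‖ ^ 4 ∂haarState d with hm
  have hsq : ∀ k, ∫ x : EuclideanSpace ℂ (Fin d), ‖x k‖ ^ 4 ∂haarState d = m := by
    intro k
    rw [← integral_inner_pow_four k (b := EuclideanSpace.single i 1) (by simp)]
    simp [hm, EuclideanSpace.inner_single_left]
  have hcross := isCovariantStrategy_norm_sq.integral_mul_norm_sq_of_ne hd hj
  have hpow : ∀ x : EuclideanSpace ℂ (Fin d), ‖x i‖ ^ 2 * ‖x i‖ ^ 2 = ‖x i‖ ^ 4 := fun x => by ring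
  simp only [hpow, ← hm] at hcross
  have hrot : ∀ c : ℂ, ‖c‖ = 1 →
      ∫ x : EuclideanSpace ℂ (Fin d), ‖x i + c * x j‖ ^ 4 ∂haarState d = 4 * m := by
    intro c hc
    have hb : ‖(EuclideanSpace.single i 1 + EuclideanSpace.single j (star c) :
        EuclideanSpace ℂ (Fin d))‖ ^ 2 = 2 := by
      rw [@norm_add_sq ℂ]
      simp [EuclideanSpace.inner_single_left, hj.symm, hc]
      norm_num
    have h := integral_inner_pow_four' i
      (EuclideanSpace.single i 1 + EuclideanSpace.single j (star c) : EuclideanSpace ℂ (Fin d))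
    rw [show 4 = 2 * 2 from rfl, pow_mul, hb] at h
    simp only [inner_add_left, EuclideanSpace.inner_single_left] at h
    rw [show (4 : ℝ) = 2 ^ 2 by norm_num]
    simpa [← hm] using h
  have hint : ∀ f : EuclideanSpace ℂ (Fin d) → ℝ, Continuous f → Integrable f (haarState d) :=
    fun f hf => haarState_integrable_of_continuous hf
  have hsum : ∫ x : EuclideanSpace ℂ (Fin d), (‖x i + x j‖ ^ 4 + ‖x i - x j‖ ^ 4 +
      ‖x i + Complex.I * x j‖ ^ 4 + ‖x i - Complex.I * x j‖ ^ 4) ∂haarState d = 16 * m := by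
    rw [integral_add (hint _ (by fun_prop)) (hint _ (by fun_prop)),
      integral_add (hint _ (by fun_prop)) (hint _ (by fun_prop)),
      integral_add (hint _ (by fun_prop)) (hint _ (by fun_prop))]
    have h1 := hrot 1 (by simp)
    have h2 := hrot (-1) (by simp)
    have h3 := hrot Complex.I (by simp)
    have h4 := hrot (-Complex.I) (by simp)
    simp only [one_mul, neg_mul, ← sub_eq_add_neg] at h1 h2 h3 h4
    rw [h1, h2, h3, h4]
    ring
  simp only [sum_norm_add_pow_four] at hsum
  rw [integral_const_mul, integral_add (hint _ (by fun_prop)) (hint _ (by fun_prop)),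
    integral_add (hint _ (by fun_prop)) (hint _ (by fun_prop)), integral_const_mul, hsq i, hsq j,
    hcross] at hsum
  have h2 : (2 : ℝ) ≤ d := by exact_mod_cast hd
  have h1 : (d : ℝ) - 1 ≠ 0 := by linarith
  have h0 : (d : ℝ) ≠ 0 := by linarith
  field_simp at hsum ⊢
  linarith

/-- The strategy `p(i|x) = (1 - |x_i|²) / (d - 1)`. -/
noncomputable def complementary {d : ℕ} (i : Fin d) (x : EuclideanSpace ℂ (Fin d)) : ℝ :=
  (1 - ‖x i‖ ^ 2) / (d - 1)

lemma isCovariantStrategy_complementary {d : ℕ} (hd : 2 ≤ d) :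
    IsCovariantStrategy (complementary (d := d)) where
  measurable i := by unfold complementary; fun_prop
  nonneg i x hx := by
    have h2 : (2 : ℝ) ≤ d := by exact_mod_cast hd
    have := pow_le_one₀ (n := 2) (norm_nonneg _) (norm_apply_le_one hx i)
    exact div_nonneg (by linarith) (by linarith)
  sum_eq_one x hx := by
    have h2 : (2 : ℝ) ≤ d := by exact_mod_cast hd
    have h1 : (d : ℝ) - 1 ≠ 0 := by linarith
    simp only [complementary]
    rw [← Finset.sum_div, Finset.sum_sub_distrib, ← EuclideanSpace.norm_sq_eq, hx]
    simp [h1]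
  phase i x y h := by simp only [complementary, h]
  perm σ i x := by simp only [complementary, permCoord_apply]

/-- This value equals $(1-\eta)/d^2+\eta/d$ at $\eta=-1/(d^2-1)$, the least parameter for which
$W_d^\eta$ is positive. -/
lemma integral_complementary {d : ℕ} [NeZero d] (hd : 2 ≤ d) (i : Fin d) :
    ∫ x, complementary i x * ‖x i‖ ^ 2 ∂haarState d = 1 / ((d : ℝ) * (d + 1)) := by
  have h2 : (2 : ℝ) ≤ d := by exact_mod_cast hd
  have h1 : (d : ℝ) - 1 ≠ 0 := by linarith
  have hexp : ∀ x : EuclideanSpace ℂ (Fin d), complementary i x * ‖x i‖ ^ 2 =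
      (‖x i‖ ^ 2 - ‖x i‖ ^ 2 * ‖x i‖ ^ 2) / (d - 1) := fun x => by
    rw [complementary]; ring
  have hpow : ∀ x : EuclideanSpace ℂ (Fin d), ‖x i‖ ^ 2 * ‖x i‖ ^ 2 = ‖x i‖ ^ 4 := fun x => by ring
  simp only [hexp]
  rw [integral_div, integral_sub (isCovariantStrategy_norm_sq.integrable i)
    (isCovariantStrategy_norm_sq.integrable_mul_norm_sq i i),
    isCovariantStrategy_norm_sq.integral_eq]
  simp only [hpow, integral_norm_pow_four hd]
  field_simp
  ring

/-- Covariant strategies realize all overlaps between those of the complementary strategy and of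
the closest-eigenstate strategy. -/
lemma exists_isCovariantStrategy {d : ℕ} [NeZero d] (hd : 2 ≤ d) {c : ℝ}
    (hc0 : 1 / ((d : ℝ) * (d + 1)) ≤ c) (hc1 : c ≤ (harmonic d : ℝ) / (d : ℝ) ^ 2) :
    ∃ p : Fin d → EuclideanSpace ℂ (Fin d) → ℝ, IsCovariantStrategy p ∧
      ∀ i, ∫ x, p i x * ‖x i‖ ^ 2 ∂haarState d = c := by
  have hseg : c ∈ segment ℝ (1 / ((d : ℝ) * (d + 1))) ((harmonic d : ℝ) / (d : ℝ) ^ 2) := by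
    rw [segment_eq_Icc (hc0.trans hc1)]
    exact ⟨hc0, hc1⟩
  obtain ⟨s, t, hs, ht, hst, rfl⟩ := hseg
  have hp := isCovariantStrategy_complementary hd
  have hq := isCovariantStrategy_tieBreakMax (d := d)
  refine ⟨_, hp.convexCombination hq hs ht hst, fun i => ?_⟩
  simp only [add_mul, mul_assoc]
  rw [integral_add ((hp.integrable_mul_norm_sq i i).const_mul s)
    ((hq.integrable_mul_norm_sq i i).const_mul t), integral_const_mul, integral_const_mul,
    integral_complementary hd, integral_tieBreakMax, smul_eq_mul, smul_eq_mul]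

/-! ### Born probabilities of eigenprojectors -/

/-- The rank-one matrix `|x⟩⟨x|`. -/
noncomputable def rankOneProj {d : ℕ} (x : EuclideanSpace ℂ (Fin d)) : Matrix (Fin d) (Fin d) ℂ :=
  Matrix.vecMulVec x.ofLp (star x.ofLp)

/-- The complex conjugate of a vector. -/
noncomputable def conjVec {d : ℕ} (x : EuclideanSpace ℂ (Fin d)) : EuclideanSpace ℂ (Fin d) :=
  WithLp.toLp 2 (star x.ofLp)

lemma conjVec_apply {d : ℕ} (x : EuclideanSpace ℂ (Fin d)) (i : Fin d) :
    conjVec x i = star (x i) := rfl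

lemma inner_conjVec_conjVec {d : ℕ} (x y : EuclideanSpace ℂ (Fin d)) :
    inner ℂ (conjVec x) (conjVec y) = star (inner ℂ x y) := by
  simp [PiLp.inner_apply, conjVec_apply]

lemma norm_conjVec {d : ℕ} (x : EuclideanSpace ℂ (Fin d)) : ‖conjVec x‖ = ‖x‖ := by
  simp [EuclideanSpace.norm_eq, conjVec_apply]

lemma conjVec_conjVec {d : ℕ} (x : EuclideanSpace ℂ (Fin d)) : conjVec (conjVec x) = x := by
  ext i; simp [conjVec_apply]

lemma norm_inner_conjVec {d : ℕ} (x y : EuclideanSpace ℂ (Fin d)) :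
    ‖inner ℂ x (conjVec y)‖ = ‖inner ℂ (conjVec x) y‖ := by
  rw [← norm_star (inner ℂ x (conjVec y)), ← inner_conjVec_conjVec, conjVec_conjVec]

lemma rankOneProj_mulVec {d : ℕ} (x y : EuclideanSpace ℂ (Fin d)) :
    Matrix.mulVec (rankOneProj x) y.ofLp = inner ℂ x y • x.ofLp := by
  rw [rankOneProj, Matrix.vecMulVec_mulVec, EuclideanSpace.inner_eq_star_dotProduct, dotProduct_comm]
  ext i; simp [mul_comm]

lemma isHermitian_rankOneProj {d : ℕ} (x : EuclideanSpace ℂ (Fin d)) :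
    (rankOneProj x).IsHermitian := by
  simp [rankOneProj, Matrix.IsHermitian, Matrix.conjTranspose_vecMulVec]

lemma posSemidef_rankOneProj {d : ℕ} (x : EuclideanSpace ℂ (Fin d)) :
    (rankOneProj x).PosSemidef :=
  Matrix.posSemidef_vecMulVec_self_star _

lemma trace_rankOneProj {d : ℕ} (x : EuclideanSpace ℂ (Fin d)) :
    (rankOneProj x).trace = ((‖x‖ ^ 2 : ℝ) : ℂ) := by
  rw [rankOneProj, Matrix.trace_vecMulVec, ← EuclideanSpace.inner_eq_star_dotProduct,
    inner_self_eq_norm_sq_to_K]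
  simp

lemma isDensityMatrix_rankOneProj {d : ℕ} {x : EuclideanSpace ℂ (Fin d)} (hx : ‖x‖ = 1) :
    IsDensityMatrix (rankOneProj x) :=
  ⟨posSemidef_rankOneProj x, by simp [trace_rankOneProj, hx]⟩

lemma Observable.proj_eq_sum {d : ℕ} (A : Observable (Fin d)) (a : ℝ) :
    A.proj a = ∑ i with A.2.eigenvalues i = a, rankOneProj (A.2.eigenvectorBasis i) := rfl

lemma bornProb_sum {d : ℕ} {ι : Type*} (s : Finset ι) (P : ι → Matrix (Fin d) (Fin d) ℂ)
    (ρ : Matrix (Fin d) (Fin d) ℂ) : bornProb (∑ i ∈ s, P i) ρ = ∑ i ∈ s, bornProb (P i) ρ := by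
  simp [bornProb, Finset.sum_mul, Matrix.trace_sum]

lemma bornProb_rankOneProj {d : ℕ} (x : EuclideanSpace ℂ (Fin d)) (ρ : Matrix (Fin d) (Fin d) ℂ) :
    bornProb (rankOneProj x) ρ = (∑ i, ∑ j, star (x i) * ρ i j * x j).re := by
  rw [bornProb, rankOneProj, Matrix.vecMulVec_mul, Matrix.trace_vecMulVec]
  simp only [dotProduct, Matrix.vecMul, Finset.mul_sum]
  rw [Finset.sum_comm]
  congr 1
  refine Finset.sum_congr rfl fun i _ => Finset.sum_congr rfl fun j _ => ?_
  simp
  ring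

lemma bornProb_rankOneProj_rankOneProj {d : ℕ} (x y : EuclideanSpace ℂ (Fin d)) :
    bornProb (rankOneProj x) (rankOneProj y) = ‖inner ℂ x y‖ ^ 2 := by
  have h : ∑ i, ∑ j, star (x i) * rankOneProj y i j * x j =
      ((‖inner ℂ x y‖ ^ 2 : ℝ) : ℂ) := by
    rw [Complex.ofReal_pow, ← Complex.mul_conj', PiLp.inner_apply, map_sum, Finset.sum_mul_sum]
    refine Finset.sum_congr rfl fun i _ => Finset.sum_congr rfl fun j _ => ?_
    simp [rankOneProj, Matrix.vecMulVec_apply]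
    ring
  rw [bornProb_rankOneProj, h, Complex.ofReal_re]

/-- A density matrix is a mixture of orthogonal pure states. -/
lemma IsDensityMatrix.exists_bornProb_eq {d : ℕ} {ρ : Matrix (Fin d) (Fin d) ℂ}
    (hρ : IsDensityMatrix ρ) :
    ∃ (c : Fin d → ℝ) (u : OrthonormalBasis (Fin d) ℂ (EuclideanSpace ℂ (Fin d))),
      (∀ m, 0 ≤ c m) ∧ ∑ m, c m = 1 ∧
      ∀ x, bornProb (rankOneProj x) ρ = ∑ m, c m * ‖inner ℂ x (u m)‖ ^ 2 := by
  have hH := hρ.1.isHermitian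
  refine ⟨hH.eigenvalues, hH.eigenvectorBasis, hρ.1.eigenvalues_nonneg, ?_, fun x => ?_⟩
  · have h := hH.trace_eq_sum_eigenvalues
    rw [hρ.2] at h
    have h' := congrArg Complex.re h
    simpa using h'.symm
  · have hspec : ρ = ∑ m, ((hH.eigenvalues m : ℝ) : ℂ) • rankOneProj (hH.eigenvectorBasis m) := by
      apply (Matrix.toEuclideanLin (𝕜 := ℂ) (m := Fin d) (n := Fin d)).injective
      refine hH.eigenvectorBasis.toBasis.ext fun k => ?_
      rw [OrthonormalBasis.coe_toBasis, Matrix.toLpLin_apply, Matrix.toLpLin_apply,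
        hH.mulVec_eigenvectorBasis, Matrix.sum_mulVec]
      simp only [Matrix.smul_mulVec, rankOneProj_mulVec]
      congr 1
      rw [Finset.sum_eq_single k]
      · simp
      · intro m _ hm
        rw [hH.eigenvectorBasis.orthonormal.2 hm]
        simp
      · simp
    have hlin : bornProb (rankOneProj x) ρ = ∑ m, hH.eigenvalues m *
        bornProb (rankOneProj x) (rankOneProj (hH.eigenvectorBasis m)) := by
      conv_lhs => rw [hspec]
      simp [bornProb, Finset.mul_sum, Matrix.trace_sum]
    rw [hlin]
    simp only [bornProb_rankOneProj_rankOneProj]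

lemma IsDensityMatrix.bornProb_nonneg {d : ℕ} {ρ : Matrix (Fin d) (Fin d) ℂ}
    (hρ : IsDensityMatrix ρ) (x : EuclideanSpace ℂ (Fin d)) : 0 ≤ bornProb (rankOneProj x) ρ := by
  obtain ⟨c, u, hc, -, h⟩ := hρ.exists_bornProb_eq
  rw [h]
  exact Finset.sum_nonneg fun m _ => mul_nonneg (hc m) (by positivity)

lemma IsDensityMatrix.bornProb_le_one {d : ℕ} {ρ : Matrix (Fin d) (Fin d) ℂ}
    (hρ : IsDensityMatrix ρ) {x : EuclideanSpace ℂ (Fin d)} (hx : ‖x‖ = 1) :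
    bornProb (rankOneProj x) ρ ≤ 1 := by
  obtain ⟨c, u, hc, hsum, h⟩ := hρ.exists_bornProb_eq
  rw [h, ← hsum]
  refine Finset.sum_le_sum fun m _ => mul_le_of_le_one_right (hc m) ?_
  have := norm_inner_le_norm (𝕜 := ℂ) x (u m)
  rw [hx, u.orthonormal.1 m, one_mul] at this
  exact pow_le_one₀ (norm_nonneg _) this

lemma maxEntangled_mul_star (d : ℕ) (x y : Fin d × Fin d) :
    maxEntangled d x * star (maxEntangled d y) =
      if x.1 = x.2 ∧ y.1 = y.2 then (((1 / d : ℝ)) : ℂ) else 0 := by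
  have h : ((1 / √(d : ℝ) : ℝ) : ℂ) * star ((1 / √(d : ℝ) : ℝ) : ℂ) = ((1 / d : ℝ) : ℂ) := by
    rw [Complex.star_def, Complex.conj_ofReal, ← Complex.ofReal_mul, div_mul_div_comm,
      Real.mul_self_sqrt d.cast_nonneg, one_mul]
  by_cases hx : x.1 = x.2 <;> by_cases hy : y.1 = y.2 <;>
  simp only [maxEntangled, hx, hy, if_true, if_false, star_zero, mul_zero, zero_mul, and_self,
    and_true, and_false, h]

/-- The joint probability of two rank-one outcomes in an isotropic state. -/
lemma bornProb_kronecker_isotropic {d : ℕ} (η : ℝ) {x y : EuclideanSpace ℂ (Fin d)}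
    (hx : ‖x‖ = 1) (hy : ‖y‖ = 1) :
    bornProb (rankOneProj x ⊗ₖ rankOneProj y) (isotropic d η) =
      (1 - η) / (d : ℝ) ^ 2 + η / d * ‖inner ℂ x (conjVec y)‖ ^ 2 := by
  have h1 : (rankOneProj x ⊗ₖ rankOneProj y).trace = 1 := by
    rw [Matrix.trace_kronecker, trace_rankOneProj, trace_rankOneProj, hx, hy]; simp
  have h2 : (rankOneProj x ⊗ₖ rankOneProj y *
      Matrix.vecMulVec (maxEntangled d) (star (maxEntangled d))).trace =
        ((1 / d * ‖inner ℂ x (conjVec y)‖ ^ 2 : ℝ) : ℂ) := by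
    -- Only the diagonal pairs $(i,i)$ and $(j,j)$ contribute, so the trace becomes
    -- $\frac1d\bigl|\sum_i x_iy_i\bigr|^2$, which is where the conjugate of $y$ enters.
    have h3 : ∀ a b : Fin d × Fin d, (rankOneProj x ⊗ₖ rankOneProj y) a b *
        Matrix.vecMulVec (maxEntangled d) (star (maxEntangled d)) b a =
        if a.1 = a.2 ∧ b.1 = b.2 then
          ((1 / d : ℝ) : ℂ) * ((x a.1 * y a.2) * star (x b.1 * y b.2)) else 0 := by
      intro a b
      rw [Matrix.vecMulVec_apply, Pi.star_apply, maxEntangled_mul_star, Matrix.kroneckerMap_apply,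
        rankOneProj, rankOneProj, Matrix.vecMulVec_apply, Matrix.vecMulVec_apply]
      by_cases ha : a.1 = a.2 <;> by_cases hb : b.1 = b.2 <;>
      simp only [ha, hb, and_self, and_true, and_false, if_true, if_false, mul_zero, star_mul',
        Pi.star_apply]
      ring
    simp only [Matrix.trace, Matrix.diag_apply, Matrix.mul_apply, h3, Fintype.sum_prod_type,
      ite_and]
    simp only [Finset.sum_ite_eq, Finset.mem_univ, if_true, Finset.sum_ite_irrel,
      Finset.sum_const_zero]
    rw [Complex.ofReal_mul, Complex.ofReal_pow, ← Complex.conj_mul', PiLp.inner_apply, map_sum,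
      Finset.sum_mul_sum, Finset.mul_sum]
    refine Finset.sum_congr rfl fun i _ => ?_
    rw [Finset.mul_sum]
    refine Finset.sum_congr rfl fun j _ => ?_
    simp [conjVec_apply]
    left
    ring
  rw [bornProb, isotropic, mul_add, Matrix.trace_add, Matrix.mul_smul, Matrix.mul_smul,
    Matrix.trace_smul, Matrix.trace_smul, mul_one, h1, h2]
  rw [smul_eq_mul, smul_eq_mul, mul_one, ← Complex.ofReal_mul, ← Complex.ofReal_add,
    Complex.ofReal_re]
  ring

lemma jointProb_isotropic {d : ℕ} (η : ℝ) (A B : Observable (Fin d)) (a b : ℝ) :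
    jointProb A a B b (isotropic d η) =
      ∑ i with A.2.eigenvalues i = a, ∑ j with B.2.eigenvalues j = b,
        ((1 - η) / (d : ℝ) ^ 2 + η / d *
          ‖inner ℂ (A.2.eigenvectorBasis i) (conjVec (B.2.eigenvectorBasis j))‖ ^ 2) := by
  have h : A.proj a ⊗ₖ B.proj b = ∑ i with A.2.eigenvalues i = a, ∑ j with B.2.eigenvalues j = b,
      rankOneProj (A.2.eigenvectorBasis i) ⊗ₖ rankOneProj (B.2.eigenvectorBasis j) := by
    rw [Observable.proj_eq_sum, Observable.proj_eq_sum]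
    ext ⟨i₁, i₂⟩ ⟨j₁, j₂⟩
    simp [Matrix.sum_apply, Finset.sum_mul_sum]
  rw [jointProb, h]
  have hlin : ∀ {ι : Type} (s : Finset ι) (P : ι → Matrix (Fin d × Fin d) (Fin d × Fin d) ℂ),
      bornProb (∑ i ∈ s, P i) (isotropic d η) = ∑ i ∈ s, bornProb (P i) (isotropic d η) := by
    intro ι s P
    simp [bornProb, Finset.sum_mul, Matrix.trace_sum]
  rw [hlin]
  refine Finset.sum_congr rfl fun i _ => ?_
  rw [hlin]
  refine Finset.sum_congr rfl fun j _ => ?_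
  exact bornProb_kronecker_isotropic η (A.2.eigenvectorBasis.orthonormal.1 i)
    (B.2.eigenvectorBasis.orthonormal.1 j)

/-- Positivity of the isotropic state bounds its parameter from below. -/
lemma isotropic_parameter_ge {d : ℕ} [NeZero d] {η : ℝ} (h : IsDensityMatrix (isotropic d η)) :
    0 ≤ (1 - η) + η * (d : ℝ) ^ 2 := by
  -- Positivity is tested on $\psi_+$ itself, an eigenvector with eigenvalue $(1-\eta)/d^2+\eta$.
  have h1 := h.1.re_dotProduct_nonneg (maxEntangled d)
  have hd : (d : ℝ) ≠ 0 := by exact_mod_cast NeZero.ne d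
  have hnorm : star (maxEntangled d) ⬝ᵥ maxEntangled d = 1 := by
    simp only [dotProduct, Pi.star_apply, mul_comm (star _), maxEntangled_mul_star, and_self,
      Fintype.sum_prod_type, Finset.sum_ite_eq, Finset.mem_univ, if_true]
    simp
  rw [isotropic, Matrix.add_mulVec, dotProduct_add, Matrix.smul_mulVec, Matrix.smul_mulVec,
    Matrix.one_mulVec, Matrix.vecMulVec_mulVec, dotProduct_smul, dotProduct_smul,
    dotProduct_smul] at h1
  simp [hnorm] at h1
  have h2 := Complex.ofReal_re ((1 - η) / (d : ℝ) ^ 2)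
  push_cast at h2
  rw [h2] at h1
  have h3 : (1 - η) + η * (d : ℝ) ^ 2 = ((1 - η) / (d : ℝ) ^ 2 + η) * (d : ℝ) ^ 2 := by
    field_simp
  rw [h3]
  exact mul_nonneg h1 (by positivity)

/-! ### Hidden-state models from covariant strategies -/

/-- The hidden-state model with a Haar-random pure state in which Alice's response to a measurement
is a covariant strategy in the eigenbasis of her observable. -/
noncomputable def haarModel {d : ℕ} [NeZero d] {p : Fin d → EuclideanSpace ℂ (Fin d) → ℝ}
    (hp : IsCovariantStrategy p) : HiddenStateModel.{u} (Fin d) (Fin d) where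
  -- The hidden variable is the unitary rather than the vector, so that Bob's state is a unit vector
  -- at every value; `ULift` only adjusts the universe.
  Ξ := ULift.{u} (Matrix.unitaryGroup (Fin d) ℂ)
  law := (haarUnitary d).map ULift.up
  isProbabilityMeasure := Measure.isProbabilityMeasure_map measurable_up.aemeasurable
  -- Bob holds the conjugate of the vector Alice compares with her basis, because $\psi_+$
  -- correlates a vector with its conjugate.
  state ξ := rankOneProj (conjVec (unitaryAct ξ.down (EuclideanSpace.single 0 1)))
  measurable_state i j := by
    have h := ((continuous_unitaryAct_left (d := d) (EuclideanSpace.single 0 1)).measurable.comp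
      measurable_down)
    have hf : Measurable fun x : EuclideanSpace ℂ (Fin d) => rankOneProj (conjVec x) i j := by
      simp only [rankOneProj, Matrix.vecMulVec_apply, conjVec_apply, Pi.star_apply]
      fun_prop
    exact hf.comp h
  isDensityMatrix_state ξ := isDensityMatrix_rankOneProj (by
    rw [norm_conjVec, norm_unitaryAct]; simp)
  response A a ξ := ∑ i with A.2.eigenvalues i = a,
    p i (A.2.eigenvectorBasis.repr (unitaryAct ξ.down (EuclideanSpace.single 0 1)))
  measurable_response A a _ := by
    refine Finset.measurable_fun_sum _ fun i _ => ?_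
    exact (hp.measurable i).comp (A.2.eigenvectorBasis.repr.continuous.measurable.comp
      ((continuous_unitaryAct_left (d := d) (EuclideanSpace.single 0 1)).measurable.comp
        measurable_down))
  response_nonneg A a _ ξ := Finset.sum_nonneg fun i _ => hp.nonneg i _ (by
    rw [LinearIsometryEquiv.norm_map, norm_unitaryAct]; simp)
  response_sum A ξ := by
    rw [Finset.sum_fiberwise_of_maps_to (t := A.outcomes) (g := A.2.eigenvalues)
      fun i _ => Finset.mem_image_of_mem _ (Finset.mem_univ i)]
    exact hp.sum_eq_one _ (by rw [LinearIsometryEquiv.norm_map, norm_unitaryAct]; simp)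

lemma integral_haarModel {d : ℕ} [NeZero d] {p : Fin d → EuclideanSpace ℂ (Fin d) → ℝ}
    (hp : IsCovariantStrategy p) {f : EuclideanSpace ℂ (Fin d) → ℝ} (hf : Measurable f) :
    ∫ ξ, f (unitaryAct ξ.down (EuclideanSpace.single 0 1)) ∂(haarModel.{u} hp).law =
      ∫ x, f x ∂haarState d := by
  have hm := (continuous_unitaryAct_left (d := d) (EuclideanSpace.single 0 1)).measurable
  rw [haarState_eq_map_single, integral_map hm.aemeasurable hf.aestronglyMeasurable]
  change ∫ ξ, f (unitaryAct (ULift.down ξ) (EuclideanSpace.single 0 1))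
    ∂(haarUnitary d).map ULift.up = _
  rw [integral_map measurable_up.aemeasurable
    (show Measurable fun ξ : ULift.{u} (Matrix.unitaryGroup (Fin d) ℂ) =>
      f (unitaryAct ξ.down (EuclideanSpace.single 0 1)) from
        hf.comp (hm.comp measurable_down)).aestronglyMeasurable]

/-- For this overlap $c$ the common off-outcome value $(1/d-c)/(d-1)$ equals $(1-\eta)/d^2$, and $c$
exceeds it by $\eta/d$: exactly the noise and signal terms of $W_d^\eta$. -/
lemma integral_covariantStrategy_mul_inner {d : ℕ} [NeZero d]
    {p : Fin d → EuclideanSpace ℂ (Fin d) → ℝ} (hp : IsCovariantStrategy p) (hd : 2 ≤ d) {η : ℝ}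
    (hc : ∀ i, ∫ x, p i x * ‖x i‖ ^ 2 ∂haarState d = (1 - η) / (d : ℝ) ^ 2 + η / d)
    (v : OrthonormalBasis (Fin d) ℂ (EuclideanSpace ℂ (Fin d))) (i : Fin d)
    {b : EuclideanSpace ℂ (Fin d)} (hb : ‖b‖ = 1) :
    ∫ x, p i (v.repr x) * ‖inner ℂ b x‖ ^ 2 ∂haarState d =
      (1 - η) / (d : ℝ) ^ 2 + η / d * ‖inner ℂ (v i) b‖ ^ 2 := by
  have h := hp.integral_mul_inner_eq hd i (v.repr b) (hc i)
  rw [← integral_comp_linearIsometryEquiv v.repr (haarState_map_linearIsometryEquiv _)] at h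
  simp only [LinearIsometryEquiv.inner_map_map, LinearIsometryEquiv.norm_map, hb,
    OrthonormalBasis.repr_apply_apply v b i] at h
  rw [h]
  have h2 : (2 : ℝ) ≤ d := by exact_mod_cast hd
  have h1 : (d : ℝ) - 1 ≠ 0 := by linarith
  have h0 : (d : ℝ) ≠ 0 := by linarith
  have h3 : (1 / (d : ℝ) - ((1 - η) / (d : ℝ) ^ 2 + η / d)) / (d - 1) = (1 - η) / (d : ℝ) ^ 2 := by
    field_simp
    ring
  rw [h3]
  ring

lemma haarModel_explains {d : ℕ} [NeZero d] {p : Fin d → EuclideanSpace ℂ (Fin d) → ℝ}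
    (hp : IsCovariantStrategy p) (hd : 2 ≤ d) {η : ℝ}
    (hc : ∀ i, ∫ x, p i x * ‖x i‖ ^ 2 ∂haarState d = (1 - η) / (d : ℝ) ^ 2 + η / d)
    (M : Set (Observable (Fin d))) : (haarModel.{u} hp).Explains M (isotropic d η) := by
  intro A _ B a _ b _
  have hpm := hp.measurable
  have hrepr : Measurable A.2.eigenvectorBasis.repr := A.2.eigenvectorBasis.repr.continuous.measurable
  rw [jointProb_isotropic]
  have hint : ∀ i j, Integrable (fun x => p i (A.2.eigenvectorBasis.repr x) *
      ‖inner ℂ (conjVec (B.2.eigenvectorBasis j)) x‖ ^ 2) (haarState d) := by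
    intro i j
    refine haarState_integrable (((hpm i).comp hrepr).mul
      (by fun_prop)).aestronglyMeasurable 1 fun x hx => ?_
    rw [norm_mul, norm_pow, norm_norm]
    refine mul_le_one₀ (hp.norm_le_one i (by rw [LinearIsometryEquiv.norm_map, hx]))
      (by positivity) (pow_le_one₀ (norm_nonneg _) ?_)
    have := norm_inner_le_norm (𝕜 := ℂ) (conjVec (B.2.eigenvectorBasis j)) x
    rwa [norm_conjVec, B.2.eigenvectorBasis.orthonormal.1 j, hx, one_mul] at this
  have hf : Measurable fun x : EuclideanSpace ℂ (Fin d) =>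
      ∑ i with A.2.eigenvalues i = a, ∑ j with B.2.eigenvalues j = b,
        p i (A.2.eigenvectorBasis.repr x) *
          ‖inner ℂ (conjVec (B.2.eigenvectorBasis j)) x‖ ^ 2 :=
    Finset.measurable_fun_sum _ fun i _ => Finset.measurable_fun_sum _ fun j _ =>
      ((hpm i).comp hrepr).mul (by fun_prop)
  have hrw : ∀ ξ, (haarModel.{u} hp).response A a ξ *
      bornProb (B.proj b) ((haarModel.{u} hp).state ξ) =
      ∑ i with A.2.eigenvalues i = a, ∑ j with B.2.eigenvalues j = b,
        p i (A.2.eigenvectorBasis.repr (unitaryAct ξ.down (EuclideanSpace.single 0 1))) *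
          ‖inner ℂ (conjVec (B.2.eigenvectorBasis j))
            (unitaryAct ξ.down (EuclideanSpace.single 0 1))‖ ^ 2 := by
    intro ξ
    change (∑ i with A.2.eigenvalues i = a,
      p i (A.2.eigenvectorBasis.repr (unitaryAct ξ.down (EuclideanSpace.single 0 1)))) *
        bornProb (B.proj b)
          (rankOneProj (conjVec (unitaryAct ξ.down (EuclideanSpace.single 0 1)))) = _
    rw [Observable.proj_eq_sum, bornProb_sum, Finset.sum_mul_sum]
    simp only [bornProb_rankOneProj_rankOneProj, norm_inner_conjVec]
  simp only [hrw]
  rw [integral_haarModel hp hf, integral_finsetSum _ fun i _ => integrable_finsetSum _ fun j _ =>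
    hint i j]
  refine Finset.sum_congr rfl fun i _ => ?_
  rw [integral_finsetSum _ fun j _ => hint i j]
  refine Finset.sum_congr rfl fun j _ => ?_
  rw [integral_covariantStrategy_mul_inner hp hd hc A.2.eigenvectorBasis i
    (by rw [norm_conjVec, B.2.eigenvectorBasis.orthonormal.1 j])]

/-- Below the boundary there is a hidden-state model for all projective measurements. -/
lemma exists_explains {d : ℕ} [NeZero d] (hd : 2 ≤ d) {η : ℝ}
    (hW : IsDensityMatrix (isotropic d η))
    (hη : η ≤ ((harmonic d : ℝ) - 1) / ((d : ℝ) - 1)) :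
    ∃ L : HiddenStateModel.{u} (Fin d) (Fin d), ∀ M, L.Explains M (isotropic d η) := by
  have h2 : (2 : ℝ) ≤ d := by exact_mod_cast hd
  have h0 : (0 : ℝ) < d := by linarith
  have h1 : (0 : ℝ) < (d : ℝ) - 1 := by linarith
  have hlow := isotropic_parameter_ge hW
  rw [le_div_iff₀ h1] at hη
  obtain ⟨p, hp, hc⟩ := exists_isCovariantStrategy hd (c := (1 - η) / (d : ℝ) ^ 2 + η / d) (by
      have h : (1 - η) / (d : ℝ) ^ 2 + η / d - 1 / ((d : ℝ) * (d + 1)) =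
          ((1 - η) + η * (d : ℝ) ^ 2) / ((d : ℝ) ^ 2 * (d + 1)) := by
        field_simp
        ring
      rw [← sub_nonneg, h]
      positivity) (by
      rw [← sub_nonneg]
      have h : (harmonic d : ℝ) / (d : ℝ) ^ 2 - ((1 - η) / (d : ℝ) ^ 2 + η / d) =
          ((harmonic d : ℝ) - 1 - η * (d - 1)) / (d : ℝ) ^ 2 := by
        field_simp
        ring
      rw [h]
      exact div_nonneg (by linarith) (by positivity))
  exact ⟨haarModel hp, haarModel_explains hp hd hc⟩

/-! ### Above the boundary, Haar-random measurements exhibit steering -/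

/-- An observable with the given eigenbasis and the eigenvalues `0, …, d - 1`. -/
noncomputable def basisObservable {d : ℕ}
    (v : OrthonormalBasis (Fin d) ℂ (EuclideanSpace ℂ (Fin d))) : Observable (Fin d) :=
  ⟨∑ k : Fin d, (((k : ℕ) : ℝ) : ℂ) • rankOneProj (v k), by
    unfold Matrix.IsHermitian
    rw [Matrix.conjTranspose_sum]
    refine Finset.sum_congr rfl fun k _ => ?_
    rw [Matrix.conjTranspose_smul, (isHermitian_rankOneProj (v k)).eq]
    simp⟩

lemma basisObservable_mulVec {d : ℕ} (v : OrthonormalBasis (Fin d) ℂ (EuclideanSpace ℂ (Fin d)))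
    (k : Fin d) :
    Matrix.mulVec (basisObservable v).1 (v k).ofLp = (((k : ℕ) : ℝ) : ℂ) • (v k).ofLp := by
  rw [basisObservable, Matrix.sum_mulVec, Finset.sum_eq_single k]
  · rw [Matrix.smul_mulVec, rankOneProj_mulVec]
    simp
  · intro m _ hm
    rw [Matrix.smul_mulVec, rankOneProj_mulVec, v.orthonormal.2 hm]
    simp
  · simp

/-- `A.proj a` maps an eigenvector of `A` to itself or to zero. -/
lemma Observable.proj_mulVec_eigenvector {d : ℕ} (A : Observable (Fin d)) (a t : ℝ)
    {x : EuclideanSpace ℂ (Fin d)} (hx : Matrix.mulVec A.1 x.ofLp = (t : ℂ) • x.ofLp) :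
    Matrix.mulVec (A.proj a) x.ofLp = if t = a then x.ofLp else 0 := by
  -- Eigenvectors of a Hermitian matrix for distinct eigenvalues are orthogonal.
  have hzero : ∀ i, A.2.eigenvalues i ≠ t → inner ℂ (A.2.eigenvectorBasis i) x = 0 := by
    intro i hi
    have h1 : (t : ℂ) * inner ℂ (A.2.eigenvectorBasis i) x =
        (A.2.eigenvalues i : ℂ) * inner ℂ (A.2.eigenvectorBasis i) x := by
      have e1 : inner ℂ (A.2.eigenvectorBasis i) (Matrix.toEuclideanLin A.1 x) =
          (t : ℂ) * inner ℂ (A.2.eigenvectorBasis i) x := by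
        rw [Matrix.toLpLin_apply, hx, WithLp.toLp_smul, inner_smul_right]
      have e2 : inner ℂ (A.2.eigenvectorBasis i) (Matrix.toEuclideanLin A.1 x) =
          (A.2.eigenvalues i : ℂ) * inner ℂ (A.2.eigenvectorBasis i) x := by
        rw [← (Matrix.isSymmetric_toEuclideanLin_iff.2 A.2) (A.2.eigenvectorBasis i) x,
          Matrix.toLpLin_apply, A.2.mulVec_eigenvectorBasis]
        rw [WithLp.toLp_smul, ← Complex.coe_smul, inner_smul_left]
        simp
      rw [← e1, e2]
    have h2 : ((t : ℂ) - A.2.eigenvalues i) ≠ 0 := by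
      rw [← Complex.ofReal_sub, Complex.ofReal_ne_zero, sub_ne_zero]
      exact hi.symm
    exact (mul_eq_zero.1 (show ((t : ℂ) - A.2.eigenvalues i) * _ = 0 by
      rw [sub_mul, h1, sub_self])).resolve_left h2
  rw [Observable.proj_eq_sum, Matrix.sum_mulVec]
  simp only [rankOneProj_mulVec]
  split_ifs with hta
  · subst hta
    have h := congrArg WithLp.ofLp (A.2.eigenvectorBasis.sum_repr' x)
    rw [WithLp.ofLp_sum] at h
    conv_rhs => rw [← h]
    refine Finset.sum_subset (Finset.filter_subset _ _) fun i _ hi => ?_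
    rw [hzero i (by simpa using hi)]
    simp
  · refine Finset.sum_eq_zero fun i hi => ?_
    rw [hzero i (by rw [(Finset.mem_filter.1 hi).2]; exact Ne.symm hta)]
    simp

/-- The eigenvalues are distinct, so each eigenspace is a line. The two matrices are compared on
`v`, since the eigenbasis inside `proj` is an unspecified choice. -/
lemma basisObservable_proj {d : ℕ} (v : OrthonormalBasis (Fin d) ℂ (EuclideanSpace ℂ (Fin d)))
    (k : Fin d) : (basisObservable v).proj ((k : ℕ) : ℝ) = rankOneProj (v k) := by
  apply (Matrix.toEuclideanLin (𝕜 := ℂ) (m := Fin d) (n := Fin d)).injective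
  refine v.toBasis.ext fun j => ?_
  rw [OrthonormalBasis.coe_toBasis, Matrix.toLpLin_apply, Matrix.toLpLin_apply,
    (basisObservable v).proj_mulVec_eigenvector _ _ (basisObservable_mulVec v j),
    rankOneProj_mulVec, orthonormal_iff_ite.1 v.orthonormal]
  by_cases h : k = j
  · simp [h]
  · simp [h, Fin.val_inj, Ne.symm h]

/-- Otherwise the spectral projector would be an empty sum, whereas its trace is one. -/
lemma basisObservable_mem_outcomes {d : ℕ}
    (v : OrthonormalBasis (Fin d) ℂ (EuclideanSpace ℂ (Fin d))) (k : Fin d) :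
    ((k : ℕ) : ℝ) ∈ (basisObservable v).outcomes := by
  by_contra h
  have h0 : (basisObservable v).proj ((k : ℕ) : ℝ) = 0 := by
    rw [Observable.proj_eq_sum]
    refine Finset.sum_eq_zero fun i hi => absurd ?_ h
    rw [← (Finset.mem_filter.1 hi).2]
    exact Finset.mem_image_of_mem _ (Finset.mem_univ i)
  have h1 := trace_rankOneProj (v k)
  rw [← basisObservable_proj, h0, v.orthonormal.1 k] at h1
  simp at h1

lemma Orthonormal.conjVec {d : ℕ} {v : Fin d → EuclideanSpace ℂ (Fin d)} (hv : Orthonormal ℂ v) :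
    Orthonormal ℂ fun k => conjVec (v k) := by
  rw [orthonormal_iff_ite]
  intro i j
  rw [inner_conjVec_conjVec, orthonormal_iff_ite.1 hv]
  split_ifs <;> simp

/-- The complex conjugate of an orthonormal basis. -/
noncomputable def conjBasis {d : ℕ} (v : OrthonormalBasis (Fin d) ℂ (EuclideanSpace ℂ (Fin d))) :
    OrthonormalBasis (Fin d) ℂ (EuclideanSpace ℂ (Fin d)) :=
  OrthonormalBasis.mk v.orthonormal.conjVec
    (v.orthonormal.conjVec.linearIndependent.span_eq_top_of_card_eq_finrank' (by simp)).ge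

lemma conjBasis_apply {d : ℕ} (v : OrthonormalBasis (Fin d) ℂ (EuclideanSpace ℂ (Fin d)))
    (k : Fin d) : conjBasis v k = conjVec (v k) := by
  simp [conjBasis]

/-- In a hidden-state model for the isotropic state, the correlations in a pair of conjugate bases
are bounded by Bob's mean largest probability. -/
lemma HiddenStateModel.Explains.ofReal_le_lintegral {d : ℕ} [NeZero d] {η : ℝ}
    {L : HiddenStateModel.{u} (Fin d) (Fin d)} (hL : L.Explains Set.univ (isotropic d η))
    (w : OrthonormalBasis (Fin d) ℂ (EuclideanSpace ℂ (Fin d))) :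
    ENNReal.ofReal ((1 - η) / d + η) ≤
      ∫⁻ ξ, ENNReal.ofReal ‖fun k => bornProb (rankOneProj (w k)) (L.state ξ)‖ ∂L.law := by
  have hprob := L.isProbabilityMeasure
  -- Alice measures the conjugate basis, so equal labels are correlated with the full weight
  -- $(1-\eta)/d^2+\eta/d$.
  let A := basisObservable (conjBasis w)
  let B := basisObservable w
  have hA : ∀ k : Fin d, ((k : ℕ) : ℝ) ∈ A.outcomes := basisObservable_mem_outcomes _
  have hdens := L.isDensityMatrix_state
  have hd : (d : ℝ) ≠ 0 := by exact_mod_cast NeZero.ne d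
  have hle1 : ∀ ξ, ∑ k : Fin d, L.response A ((k : ℕ) : ℝ) ξ ≤ 1 := by
    intro ξ
    have hinj : Function.Injective fun k : Fin d => ((k : ℕ) : ℝ) := fun i j h =>
      Fin.ext (Nat.cast_injective h)
    rw [← L.response_sum A ξ, ← Finset.sum_image (f := fun a => L.response A a ξ)
      (g := fun k : Fin d => ((k : ℕ) : ℝ)) hinj.injOn]
    refine Finset.sum_le_sum_of_subset_of_nonneg ?_ fun a ha _ => L.response_nonneg A a ha ξ
    intro a ha
    obtain ⟨k, -, rfl⟩ := Finset.mem_image.1 ha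
    exact hA k
  have hmeasborn : ∀ k, Measurable fun ξ => bornProb (rankOneProj (w k)) (L.state ξ) := by
    intro k
    have := L.measurable_state
    simp only [bornProb_rankOneProj]
    fun_prop
  have hint : ∀ k : Fin d, Integrable (fun ξ => L.response A ((k : ℕ) : ℝ) ξ *
      bornProb (rankOneProj (w k)) (L.state ξ)) L.law := by
    intro k
    refine Integrable.of_bound ((L.measurable_response A _ (hA k)).mul
      (hmeasborn k)).aestronglyMeasurable 1 (Eventually.of_forall fun ξ => ?_)
    have h0 := L.response_nonneg A _ (hA k) ξ
    have h1 := (hdens ξ).bornProb_nonneg (w k)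
    rw [Real.norm_of_nonneg (mul_nonneg h0 h1)]
    refine mul_le_one₀ ?_ h1 ((hdens ξ).bornProb_le_one (w.orthonormal.1 k))
    exact (Finset.single_le_sum (f := fun k : Fin d => L.response A ((k : ℕ) : ℝ) ξ)
      (fun j _ => L.response_nonneg A _ (hA j) ξ) (Finset.mem_univ k)).trans (hle1 ξ)
  have hval : ∀ k : Fin d, ∫ ξ, L.response A ((k : ℕ) : ℝ) ξ *
      bornProb (rankOneProj (w k)) (L.state ξ) ∂L.law = (1 - η) / (d : ℝ) ^ 2 + η / d := by
    intro k
    have h := hL A (Set.mem_univ A) B _ (hA k) _ (basisObservable_mem_outcomes w k)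
    rw [jointProb, basisObservable_proj, basisObservable_proj, conjBasis_apply,
      bornProb_kronecker_isotropic η (by rw [norm_conjVec, w.orthonormal.1 k])
        (w.orthonormal.1 k), inner_self_eq_norm_sq_to_K, norm_conjVec, w.orthonormal.1 k] at h
    rw [← h]
    simp
  have hsum : (1 - η) / d + η = ∫ ξ, ∑ k : Fin d, L.response A ((k : ℕ) : ℝ) ξ *
      bornProb (rankOneProj (w k)) (L.state ξ) ∂L.law := by
    rw [integral_finsetSum _ fun k _ => hint k]
    simp only [hval, Finset.sum_const, Finset.card_univ, Fintype.card_fin, nsmul_eq_mul]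
    field_simp
  have hnonneg : ∀ ξ, 0 ≤ ∑ k : Fin d, L.response A ((k : ℕ) : ℝ) ξ *
      bornProb (rankOneProj (w k)) (L.state ξ) := fun ξ =>
    Finset.sum_nonneg fun k _ => mul_nonneg (L.response_nonneg A _ (hA k) ξ)
      ((hdens ξ).bornProb_nonneg (w k))
  rw [hsum, ofReal_integral_eq_lintegral_ofReal (integrable_finsetSum _ fun k _ => hint k)
    (Eventually.of_forall hnonneg)]
  refine lintegral_mono fun ξ => ENNReal.ofReal_le_ofReal ?_
  calc ∑ k : Fin d, L.response A ((k : ℕ) : ℝ) ξ * bornProb (rankOneProj (w k)) (L.state ξ)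
      ≤ ∑ k : Fin d, L.response A ((k : ℕ) : ℝ) ξ *
          ‖fun k => bornProb (rankOneProj (w k)) (L.state ξ)‖ :=
        Finset.sum_le_sum fun k _ => mul_le_mul_of_nonneg_left
          ((le_abs_self _).trans (norm_le_pi_norm
            (fun k => bornProb (rankOneProj (w k)) (L.state ξ)) k))
          (L.response_nonneg A _ (hA k) ξ)
    _ ≤ ‖fun k => bornProb (rankOneProj (w k)) (L.state ξ)‖ := by
        rw [← Finset.sum_mul]
        exact mul_le_of_le_one_left (norm_nonneg _) (hle1 ξ)

lemma orthonormal_unitaryAct_single {d : ℕ} (U : Matrix.unitaryGroup (Fin d) ℂ) :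
    Orthonormal ℂ fun k : Fin d => unitaryAct U (EuclideanSpace.single k 1) := by
  rw [orthonormal_iff_ite]
  intro i j
  rw [inner_unitaryAct_unitaryAct, EuclideanSpace.inner_single_left]
  simp

/-- The orthonormal basis `U⁻¹|k⟩`. -/
noncomputable def unitaryBasis {d : ℕ} (U : Matrix.unitaryGroup (Fin d) ℂ) :
    OrthonormalBasis (Fin d) ℂ (EuclideanSpace ℂ (Fin d)) :=
  OrthonormalBasis.mk (orthonormal_unitaryAct_single U⁻¹)
    ((orthonormal_unitaryAct_single U⁻¹).linearIndependent.span_eq_top_of_card_eq_finrank'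
      (by simp)).ge

lemma unitaryBasis_apply {d : ℕ} (U : Matrix.unitaryGroup (Fin d) ℂ) (k : Fin d) :
    unitaryBasis U k = unitaryAct U⁻¹ (EuclideanSpace.single k 1) := by
  simp [unitaryBasis]

/-- The reason for the inverse in `unitaryBasis`: measuring $x$ in this basis reads off the
coordinates of $Ux$, which is Haar-distributed when $x$ is a unit vector. -/
lemma inner_unitaryBasis {d : ℕ} (U : Matrix.unitaryGroup (Fin d) ℂ) (k : Fin d)
    (x : EuclideanSpace ℂ (Fin d)) : inner ℂ (unitaryBasis U k) x = unitaryAct U x k := by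
  rw [unitaryBasis_apply, inner_unitaryAct, inv_inv, EuclideanSpace.inner_single_left]
  simp

lemma unitaryBasis_apply_apply {d : ℕ} (U : Matrix.unitaryGroup (Fin d) ℂ) (k i : Fin d) :
    unitaryBasis U k i = star ((U : Matrix (Fin d) (Fin d) ℂ) k i) := by
  rw [unitaryBasis_apply, unitaryAct_single]
  rfl

/-- For every state, the mean over Haar-random bases of the largest outcome probability is at most
`H_d / d`. -/
lemma lintegral_haarUnitary_bornProb_le {d : ℕ} [NeZero d] {ρ : Matrix (Fin d) (Fin d) ℂ}
    (hρ : IsDensityMatrix ρ) :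
    ∫⁻ U, ENNReal.ofReal ‖fun k => bornProb (rankOneProj (unitaryBasis U k)) ρ‖ ∂haarUnitary d ≤
      ENNReal.ofReal ((harmonic d : ℝ) / d) := by
  obtain ⟨c, u, hc, hsum, h⟩ := hρ.exists_bornProb_eq
  -- Convexity: the largest probability of a mixture is at most the mixture of the largest
  -- probabilities of its pure components.
  have hle : ∀ U, ‖fun k => bornProb (rankOneProj (unitaryBasis U k)) ρ‖ ≤
      ∑ m, c m * ‖(unitaryAct U (u m)).ofLp‖ ^ 2 := by
    intro U
    refine (pi_norm_le_iff_of_nonneg (Finset.sum_nonneg fun m _ =>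
      mul_nonneg (hc m) (by positivity))).2 fun k => ?_
    rw [Real.norm_of_nonneg (hρ.bornProb_nonneg _), h]
    refine Finset.sum_le_sum fun m _ => mul_le_mul_of_nonneg_left ?_ (hc m)
    rw [inner_unitaryBasis]
    exact norm_apply_sq_le_norm_ofLp_sq _ k
  have hm : ∀ m, Measurable fun U : Matrix.unitaryGroup (Fin d) ℂ =>
      ENNReal.ofReal (‖(unitaryAct U (u m)).ofLp‖ ^ 2) := fun m =>
    (show Measurable fun x : EuclideanSpace ℂ (Fin d) => ENNReal.ofReal (‖x.ofLp‖ ^ 2)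
      by fun_prop).comp (continuous_unitaryAct_left (u m)).measurable
  have hval : ∀ m, ∫⁻ U, ENNReal.ofReal (‖(unitaryAct U (u m)).ofLp‖ ^ 2) ∂haarUnitary d =
      ENNReal.ofReal ((harmonic d : ℝ) / d) := by
    intro m
    rw [← lintegral_haarState_norm_ofLp_sq, ← map_unitaryAct_haarUnitary (u.orthonormal.1 m),
      lintegral_map (by fun_prop) (continuous_unitaryAct_left (u m)).measurable]
  calc ∫⁻ U, ENNReal.ofReal ‖fun k => bornProb (rankOneProj (unitaryBasis U k)) ρ‖ ∂haarUnitary d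
      ≤ ∫⁻ U, ∑ m, ENNReal.ofReal (c m) * ENNReal.ofReal (‖(unitaryAct U (u m)).ofLp‖ ^ 2)
          ∂haarUnitary d := by
        refine lintegral_mono fun U => (ENNReal.ofReal_le_ofReal (hle U)).trans_eq ?_
        rw [ENNReal.ofReal_sum_of_nonneg fun m _ => mul_nonneg (hc m) (by positivity)]
        simp only [ENNReal.ofReal_mul (hc _)]
    _ = ∑ m, ENNReal.ofReal (c m) * ENNReal.ofReal ((harmonic d : ℝ) / d) := by
        rw [lintegral_finsetSum _ fun m _ => (hm m).const_mul _]
        simp only [lintegral_const_mul _ (hm _), hval]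
    _ = ENNReal.ofReal ((harmonic d : ℝ) / d) := by
        rw [← Finset.sum_mul, ← ENNReal.ofReal_sum_of_nonneg fun m _ => hc m, hsum,
          ENNReal.ofReal_one, one_mul]

/-- A hidden-state model for all projective measurements exists only below the boundary. -/
lemma HiddenStateModel.Explains.parameter_le {d : ℕ} [NeZero d] (hd : 2 ≤ d) {η : ℝ}
    {L : HiddenStateModel.{u} (Fin d) (Fin d)} (hL : L.Explains Set.univ (isotropic d η)) :
    η ≤ ((harmonic d : ℝ) - 1) / ((d : ℝ) - 1) := by
  have hprob := L.isProbabilityMeasure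
  -- The exchange of integrals involves only Bob's states and the entries of $U$, which are jointly
  -- measurable.
  have hmeas : Measurable (Function.uncurry fun (U : Matrix.unitaryGroup (Fin d) ℂ) (ξ : L.Ξ) =>
      ENNReal.ofReal ‖fun k => bornProb (rankOneProj (unitaryBasis U k)) (L.state ξ)‖) := by
    have h1 := L.measurable_state
    have h2 := measurable_unitaryGroup_entry (d := d)
    have h3 : ∀ k, Measurable fun q : Matrix.unitaryGroup (Fin d) ℂ × L.Ξ =>
        bornProb (rankOneProj (unitaryBasis q.1 k)) (L.state q.2) := by
      intro k
      simp only [bornProb_rankOneProj, unitaryBasis_apply_apply, star_star]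
      refine Complex.measurable_re.comp (Finset.measurable_fun_sum _ fun i _ =>
        Finset.measurable_fun_sum _ fun j _ => ?_)
      exact (((h2 k i).comp measurable_fst).mul ((h1 i j).comp measurable_snd)).mul
        (continuous_star.measurable.comp ((h2 k j).comp measurable_fst))
    exact ((measurable_pi_lambda _ h3).norm).ennreal_ofReal
  have hle : ENNReal.ofReal ((1 - η) / d + η) ≤ ENNReal.ofReal ((harmonic d : ℝ) / d) := by
    calc ENNReal.ofReal ((1 - η) / d + η)
        = ∫⁻ _, ENNReal.ofReal ((1 - η) / d + η) ∂haarUnitary d := by simp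
      _ ≤ ∫⁻ U, ∫⁻ ξ, ENNReal.ofReal ‖fun k =>
            bornProb (rankOneProj (unitaryBasis U k)) (L.state ξ)‖ ∂L.law ∂haarUnitary d :=
          lintegral_mono fun U => hL.ofReal_le_lintegral (unitaryBasis U)
      _ = ∫⁻ ξ, ∫⁻ U, ENNReal.ofReal ‖fun k =>
            bornProb (rankOneProj (unitaryBasis U k)) (L.state ξ)‖ ∂haarUnitary d ∂L.law :=
          lintegral_lintegral_swap hmeas.aemeasurable
      _ ≤ ∫⁻ _, ENNReal.ofReal ((harmonic d : ℝ) / d) ∂L.law :=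
          lintegral_mono fun ξ => lintegral_haarUnitary_bornProb_le (L.isDensityMatrix_state ξ)
      _ = ENNReal.ofReal ((harmonic d : ℝ) / d) := by simp
  rw [ENNReal.ofReal_le_ofReal_iff (div_nonneg (harmonic_cast_nonneg d) d.cast_nonneg)] at hle
  have h2 : (2 : ℝ) ≤ d := by exact_mod_cast hd
  have h0 : (0 : ℝ) < d := by linarith
  rw [le_div_iff₀ (by linarith)]
  have h3 := mul_le_mul_of_nonneg_right hle h0.le
  rw [add_mul, div_mul_cancel₀ _ h0.ne', div_mul_cancel₀ _ h0.ne'] at h3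
  linarith

/-! ### Asymptotics of the boundary -/

/-- $H_d-1-\ln d$ converges, so it is negligible against $\ln d$; likewise $d-1\sim d$. -/
lemma harmonic_boundary_isEquivalent :
    (fun d : ℕ => ((harmonic d : ℝ) - 1) / ((d : ℝ) - 1)) ~[atTop]
      (fun d : ℕ => Real.log d / (d : ℝ)) := by
  have hlog : Tendsto (fun d : ℕ => Real.log d) atTop atTop :=
    Real.tendsto_log_atTop.comp tendsto_natCast_atTop_atTop
  have hnum : (fun d : ℕ => (harmonic d : ℝ) - 1) ~[atTop] fun d : ℕ => Real.log d := by
    have h : Tendsto (fun d : ℕ => (harmonic d : ℝ) - 1 - Real.log d) atTop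
        (nhds (Real.eulerMascheroniConstant - 1)) := by
      refine (Real.tendsto_harmonic_sub_log.sub_const 1).congr fun d => by ring
    exact (h.isBigO_one ℝ).trans_isLittleO (isLittleO_const_left.2
      (Or.inr (tendsto_norm_atTop_atTop.comp hlog)))
  have hden : (fun d : ℕ => (d : ℝ) - 1) ~[atTop] fun d : ℕ => (d : ℝ) := by
    have h : (fun d : ℕ => (d : ℝ) - 1 - d) =o[atTop] fun d : ℕ => (d : ℝ) := by
      simp only [sub_sub_cancel_left]
      exact isLittleO_const_left.2 (Or.inr (tendsto_norm_atTop_atTop.comp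
        tendsto_natCast_atTop_atTop))
    exact h
  exact hnum.div hden

/-! ### The steering criterion and the optimal overlap -/

theorem mainTheorem4 :
    (∀ (d : ℕ) [NeZero d], 2 ≤ d →
      -- the steering boundary
      (∀ η : ℝ, IsDensityMatrix (isotropic d η) →
        (Steerable.{u} (isotropic d η) ↔ ((harmonic d : ℝ) - 1) / ((d : ℝ) - 1) < η) ∧
        (ExhibitsSteering.{u} Set.univ (isotropic d η) ↔
          ((harmonic d : ℝ) - 1) / ((d : ℝ) - 1) < η)) ∧
      -- the maximal simulated overlap for the Haar ensemble
      (∀ v : OrthonormalBasis (Fin d) ℂ (EuclideanSpace ℂ (Fin d)),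
        IsCheatingStrategy (haarState d) (closestEigenstate v) ∧
        (∀ a, overlap (haarState d) v (closestEigenstate v) a = (harmonic d : ℝ) / (d : ℝ) ^ 2) ∧
        (∀ p, IsCheatingStrategy (haarState d) p →
          (∑ a, overlap (haarState d) v p a) / (d : ℝ) ≤ (harmonic d : ℝ) / (d : ℝ) ^ 2) ∧
        IsGreatest {x : ℝ | ∃ p, IsCheatingStrategy (haarState d) p ∧
          ∀ a, overlap (haarState d) v p a = x} ((harmonic d : ℝ) / (d : ℝ) ^ 2)) ∧
      -- the complex Gaussian representation of the Haar ensemble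
      ((gaussianState d).map (fun φ => (((‖φ‖⁻¹ : ℝ) : ℂ) • φ, ‖φ‖)) =
          (haarState d).prod ((gaussianState d).map fun φ => ‖φ‖)) ∧
      (∀ (v : OrthonormalBasis (Fin d) ℂ (EuclideanSpace ℂ (Fin d))) (a : Fin d),
        overlap (gaussianState d) v (closestEigenstate v) a =
          (harmonic d : ℝ) / (d : ℝ) ^ 2)) ∧
    -- the asymptotics of the steering boundary
    (fun d : ℕ => ((harmonic d : ℝ) - 1) / ((d : ℝ) - 1)) ~[atTop]
      (fun d : ℕ => Real.log d / (d : ℝ)) := by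
  refine ⟨fun d _ hd => ⟨fun η hW => ?_, fun v => ⟨isCheatingStrategy_closestEigenstate v,
    haarState_overlap_closestEigenstate v, fun p hp => haarState_average_overlap_le v hp,
    isGreatest_overlap v⟩, gaussianState_map_direction_norm d,
    gaussianState_overlap_closestEigenstate⟩, harmonic_boundary_isEquivalent⟩
  -- Up to and including the boundary a single model explains every set of measurements, and beyond
  -- it the set of all measurements already steers, so the two criteria coincide.
  have hbelow : ∀ M, ExhibitsSteering.{u} M (isotropic d η) →
      ((harmonic d : ℝ) - 1) / ((d : ℝ) - 1) < η := by
    intro M hM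
    by_contra hη
    obtain ⟨L, hL⟩ := exists_explains.{u} hd hW (not_lt.1 hη)
    exact hM ⟨L, hL M⟩
  have habove : ((harmonic d : ℝ) - 1) / ((d : ℝ) - 1) < η →
      ExhibitsSteering.{u} Set.univ (isotropic d η) := by
    rintro hη ⟨L, hL⟩
    exact absurd (hL.parameter_le hd) (not_le.2 hη)
  exact ⟨⟨fun ⟨M, hM⟩ => hbelow M hM, fun hη => ⟨Set.univ, habove hη⟩⟩, hbelow _, habove⟩
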